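/- For $n\ge 0$ let $F\in\mathbb{C}^{2n\times 2n}$ be the unitary DFT matrix, $F_{k,a}=\frac{1}{\sqrt{2n}}e^{-2\pi i ka/(2n)}$ ($0\le k,a<2n$). Let $v=(1,\dots,1,0,\dots,0)\in\mathbb{R}^{2n}$ ($n$ ones followed by $n$ zeros), let $\hat v_k=\sum_{a=0}^{2n-1}v_a e^{-2\pi i ka/(2n)}$ and $\Sigma=\mathrm{diag}(\hat v)$, and let $\sqrt{\Sigma}$ be the entrywise principal square root of this diagonal matrix. Let $E\in\mathbb{R}^{2n\times n}$ embed $\mathbb{R}^n$ as the first $n$ coordinates of $\mathbb{R}^{2n}$. Let $C_F=F^*\sqrt{\Sigma}\,F\,E$ be the (real, $2n\times n$) FFT encoder. Let $S\in\mathbb{R}^{n\times n}$ be the prefix-sum matrix (ones on and below the diagonal, zeros above it), and let $B_{F\mathrm{opt}}=S\,C_F^{\dagger}$, an $n\times 2n$ matrix, be the optimal decoder, where $\dagger$ denotes the Moore--Penrose inverse. Then the map $b\mapsto B_{F\mathrm{opt}}\,b$, $b\in\mathbb{R}^{2n}$, may be evaluated in $O(n\log^2 n)$ time. That is, there is a single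 program for a real RAM which, for every $n$ and every $b\in\mathbb{R}^{2n}$, given $n$ and the entries of $b$ as input, computes the vector $B_{F\mathrm{opt}}\,b$ exactly and halts after at most $T(n)$ steps, where $T(n)=O(n\log^2 n)$ as $n\to\infty$. Here the real RAM performs, at unit cost each: exact real $+,-,\times,\div$, square roots and comparisons, the formation of $\cos(\pi/N)$ and $\sin(\pi/N)$ for a natural number $N$ that it holds, integer constants, addition, truncated subtraction, halving and comparison of natural numbers (counters and addresses), indirect memory access, and control flow (branching, loops, procedure calls). -/

import Mathlib

open Matrix

/-! ## Matrices: DFT, encoder, Moore–Penrose inverse, optimal decoder -/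

namespace FFTMech

/-- The four Penrose equations: `X` is the Moore–Penrose inverse of `A`. -/
structure IsMoorePenrose {m n : Type*} [Fintype m] [Fintype n]
    (A : Matrix m n ℂ) (X : Matrix n m ℂ) : Prop where
  mul_mul_self : A * X * A = A
  self_mul_mul : X * A * X = X
  isHermitian_left : (A * X).IsHermitian
  isHermitian_right : (X * A).IsHermitian

open scoped ComplexOrder in
/-- Every complex matrix has a Moore–Penrose inverse. -/
theorem exists_isMoorePenrose {m n : Type*} [Fintype m] [Fintype n]
    (A : Matrix m n ℂ) : ∃ X : Matrix n m ℂ, IsMoorePenrose A X := by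
  classical
  have hH : (Aᴴ * A).IsHermitian := isHermitian_conjTranspose_mul_self A
  set H := Aᴴ * A with hHdef
  obtain ⟨U, d, hU1, hHU⟩ : ∃ (U : Matrix n n ℂ) (d : n → ℝ),
      Uᴴ * U = 1 ∧ H = U * diagonal (fun i => (d i : ℂ)) * Uᴴ := by
    refine ⟨hH.eigenvectorUnitary, hH.eigenvalues, ?_, ?_⟩
    · exact Unitary.coe_star_mul_self hH.eigenvectorUnitary
    · conv_lhs => rw [hH.spectral_theorem]
      rw [Unitary.conjStarAlgAut_apply]
      rfl
  set D : Matrix n n ℂ := diagonal (fun i => (d i : ℂ)) with hD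
  set E : Matrix n n ℂ := diagonal (fun i => ((d i)⁻¹ : ℂ)) with hE
  have hDE : D * E = E * D := by simp [hD, hE, mul_comm]
  have hDED : D * E * D = D := by
    simp only [hD, hE, diagonal_mul_diagonal]
    congr 1; funext i
    by_cases h : (d i : ℂ) = 0 <;> simp [h]
  have hEDE : E * D * E = E := by
    simp only [hD, hE, diagonal_mul_diagonal]
    congr 1; funext i
    by_cases h : (d i : ℂ) = 0 <;> simp [h]
  have hEh : Eᴴ = E := by
    simp only [hE, diagonal_conjTranspose]
    congr 1; funext i; simp
  set G : Matrix n n ℂ := U * E * Uᴴ with hG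
  have hmul (P Q : Matrix n n ℂ) : (U * P * Uᴴ) * (U * Q * Uᴴ) = U * (P * Q) * Uᴴ := by
    calc (U * P * Uᴴ) * (U * Q * Uᴴ) = U * P * (Uᴴ * U) * Q * Uᴴ := by
          simp only [Matrix.mul_assoc]
      _ = U * (P * Q) * Uᴴ := by rw [hU1]; simp only [Matrix.mul_one, Matrix.mul_assoc]
  have hGH : Gᴴ = G := by
    simp only [hG, conjTranspose_mul, conjTranspose_conjTranspose, hEh, Matrix.mul_assoc]
  have hcomm : H * G = G * H := by rw [hHU, hG, hmul, hmul, hDE]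
  have hHGH : H * G * H = H := by rw [hHU, hG, hmul, hmul, hDED]
  have hGHG : G * H * G = G := by rw [hHU, hG, hmul, hmul, hEDE]
  have hAGH : A * (G * H) = A := by
    have h0 : A * (G * H) - A = 0 := by
      rw [← conjTranspose_mul_self_eq_zero]
      have : (A * (G * H) - A)ᴴ * (A * (G * H) - A)
          = (H * G) * (H * G * H - H) - (H * G * H - H) := by
        simp only [conjTranspose_sub, conjTranspose_mul, hGH, hHdef,
          conjTranspose_conjTranspose]
        simp only [Matrix.sub_mul, Matrix.mul_sub, Matrix.mul_assoc]
      rw [this, hHGH]; simp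
    exact sub_eq_zero.mp h0
  refine ⟨G * Aᴴ, ?_, ?_, ?_, ?_⟩
  · calc A * (G * Aᴴ) * A = A * (G * H) := by simp only [hHdef, Matrix.mul_assoc]
      _ = A := hAGH
  · calc G * Aᴴ * A * (G * Aᴴ) = G * H * G * Aᴴ := by simp only [hHdef, Matrix.mul_assoc]
      _ = G * Aᴴ := by rw [hGHG]
  · simp only [IsHermitian, conjTranspose_mul, conjTranspose_conjTranspose, hGH, Matrix.mul_assoc]
  · have : G * Aᴴ * A = G * H := by simp only [hHdef, Matrix.mul_assoc]
    rw [this, IsHermitian, conjTranspose_mul, hGH, hH.eq, hcomm]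

/-- The Moore–Penrose inverse is unique. -/
theorem IsMoorePenrose.unique {m n : Type*} [Fintype m] [Fintype n]
    {A : Matrix m n ℂ} {X Y : Matrix n m ℂ}
    (hX : IsMoorePenrose A X) (hY : IsMoorePenrose A Y) : X = Y := by
  have h1 : A * X = A * Y := by
    calc A * X = (A * Y * A) * X := by rw [hY.mul_mul_self]
      _ = (A * Y)ᴴ * (A * X)ᴴ := by
          rw [hY.isHermitian_left.eq, hX.isHermitian_left.eq, Matrix.mul_assoc (A * Y)]
      _ = (A * X * A * Y)ᴴ := by rw [← conjTranspose_mul, Matrix.mul_assoc (A * X)]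
      _ = A * Y := by rw [hX.mul_mul_self, hY.isHermitian_left.eq]
  have h2 : X * A = Y * A := by
    calc X * A = X * (A * Y * A) := by rw [hY.mul_mul_self]
      _ = (X * A)ᴴ * (Y * A)ᴴ := by
          rw [hY.isHermitian_right.eq, hX.isHermitian_right.eq]; simp only [Matrix.mul_assoc]
      _ = (Y * (A * X * A))ᴴ := by rw [← conjTranspose_mul]; simp only [Matrix.mul_assoc]
      _ = Y * A := by rw [hX.mul_mul_self, hY.isHermitian_right.eq]
  calc X = X * A * X := hX.self_mul_mul.symm
    _ = Y * A * Y := by rw [h2, Matrix.mul_assoc, h1, ← Matrix.mul_assoc]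
    _ = Y := hY.self_mul_mul

/-- The Moore–Penrose inverse `A†`. -/
noncomputable def pinv {m n : Type*} [Fintype m] [Fintype n] (A : Matrix m n ℂ) : Matrix n m ℂ :=
  Classical.choose (exists_isMoorePenrose A)

theorem pinv_spec {m n : Type*} [Fintype m] [Fintype n] (A : Matrix m n ℂ) :
    IsMoorePenrose A (pinv A) :=
  Classical.choose_spec (exists_isMoorePenrose A)

/-- The unitary DFT matrix of size `N`, with entries `exp (-2πi k a / N) / √N`. -/
noncomputable def dftMatrix (N : ℕ) : Matrix (Fin N) (Fin N) ℂ :=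
  Matrix.of fun k a =>
    ((Real.sqrt N : ℝ) : ℂ)⁻¹ *
      Complex.exp (-(2 * Real.pi * Complex.I * (k : ℂ) * (a : ℂ) / (N : ℂ)))

/-- The (unnormalized) DFT of a vector: `∑ a, v a * exp (-2πi k a / N)`. -/
noncomputable def dftVec {N : ℕ} (v : Fin N → ℂ) (k : Fin N) : ℂ :=
  ∑ a : Fin N, v a * Complex.exp (-(2 * Real.pi * Complex.I * (k : ℂ) * (a : ℂ) / (N : ℂ)))

/-- The vector `(1, …, 1, 0, …, 0)` with `n` ones and `n` zeros: the first column of the circulant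
matrix of size `2n` that extends the prefix-sum matrix. -/
def circVec (n : ℕ) : Fin (2 * n) → ℂ := fun a => if (a : ℕ) < n then 1 else 0

/-- `√Σ`, where `Σ` is the diagonal matrix of the DFT of `circVec n`; `Complex.sqrt` is the
principal square root. -/
noncomputable def sqrtSigma (n : ℕ) : Matrix (Fin (2 * n)) (Fin (2 * n)) ℂ :=
  Matrix.diagonal fun k => Complex.sqrt (dftVec (circVec n) k)

/-- The embedding of `n`-dimensional space as the first `n` of `2n` coordinates. -/
def embedMatrix (n : ℕ) : Matrix (Fin (2 * n)) (Fin n) ℂ :=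
  Matrix.of fun i j => if (i : ℕ) = (j : ℕ) then 1 else 0

/-- The prefix-sum matrix: ones on and below the main diagonal. -/
def prefixSum (n : ℕ) : Matrix (Fin n) (Fin n) ℂ :=
  Matrix.of fun i j => if j ≤ i then 1 else 0

/-- The FFT encoder `C_F = F* √Σ F E`, of shape `2n × n`. (Its entries happen to be real.) -/
noncomputable def encoder (n : ℕ) : Matrix (Fin (2 * n)) (Fin n) ℂ :=
  (dftMatrix (2 * n))ᴴ * (sqrtSigma n * dftMatrix (2 * n) * embedMatrix n)

/-- The optimal decoder `B_Fopt = S C_F†`, of shape `n × 2n`. -/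
noncomputable def optDecoder (n : ℕ) : Matrix (Fin n) (Fin (2 * n)) ℂ :=
  prefixSum n * pinv (encoder n)

end FFTMech

/-! ## The real RAM with unit-cost arithmetic

The machine has natural-number registers and an addressable natural-number memory (for counters,
addresses and stacks), and real registers and an addressable real memory. Every operation, test
and memory access costs one unit. Natural numbers are used through addition, truncated
subtraction, halving and comparison only, and there is no conversion from real numbers to natural
numbers. -/

namespace RealRAM

/-- A machine state. -/
structure State where
  /-- natural-number registers -/
  nreg : ℕ → ℕ
  /-- natural-number memory -/
  nmem : ℕ → ℕ
  /-- real registers -/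
  rreg : ℕ → ℝ
  /-- real memory -/
  rmem : ℕ → ℝ

/-- Natural-number expressions. -/
inductive NExp where
  | const (c : ℕ)
  | reg (x : ℕ)
  | load (e : NExp)
  | add (e f : NExp)
  | sub (e f : NExp)
  | half (e : NExp)

/-- Real expressions. Besides the field operations and the square root there are `cos (π / N)` and
`sin (π / N)` for a natural number `N`, that is, a primitive root of unity of order `2N`. -/
inductive RExp where
  | const (c : ℤ)
  | reg (x : ℕ)
  | load (e : NExp)
  | add (e f : RExp)
  | sub (e f : RExp)
  | mul (e f : RExp)
  | div (e f : RExp)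
  | sqrt (e : RExp)
  | cosPi (e : NExp)
  | sinPi (e : NExp)

/-- Tests. -/
inductive BExp where
  | nle (e f : NExp)
  | rle (e f : RExp)
  | not (b : BExp)

/-- Commands. `call i` runs the `i`-th procedure; all registers and memory are global, so a
recursive procedure has to keep its own stack in memory. -/
inductive Cmd where
  | skip
  | setN (x : ℕ) (e : NExp)
  | storeN (a e : NExp)
  | setR (x : ℕ) (e : RExp)
  | storeR (a : NExp) (e : RExp)
  | seq (c d : Cmd)
  | ite (b : BExp) (c d : Cmd)
  | while (b : BExp) (c : Cmd)
  | call (i : ℕ)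

/-- A program: a main command and finitely many procedure bodies. -/
structure Program where
  main : Cmd
  procs : List Cmd

/-- The value of a natural-number expression. -/
def NExp.eval (s : State) : NExp → ℕ
  | .const c => c
  | .reg x => s.nreg x
  | .load e => s.nmem (e.eval s)
  | .add e f => e.eval s + f.eval s
  | .sub e f => e.eval s - f.eval s
  | .half e => e.eval s / 2

/-- The cost of evaluating a natural-number expression: the number of its nodes. -/
def NExp.cost : NExp → ℕ
  | .const _ => 1
  | .reg _ => 1
  | .load e => e.cost + 1
  | .add e f => e.cost + f.cost + 1
  | .sub e f => e.cost + f.cost + 1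
  | .half e => e.cost + 1

/-- The value of a real expression. (A quotient by `0` and the square root of a negative number
are `0`; since programs can test for these cases, this changes no running time by more than a
constant factor.) -/
noncomputable def RExp.eval (s : State) : RExp → ℝ
  | .const c => (c : ℝ)
  | .reg x => s.rreg x
  | .load e => s.rmem (e.eval s)
  | .add e f => e.eval s + f.eval s
  | .sub e f => e.eval s - f.eval s
  | .mul e f => e.eval s * f.eval s
  | .div e f => e.eval s / f.eval s
  | .sqrt e => Real.sqrt (e.eval s)
  | .cosPi e => Real.cos (Real.pi / (e.eval s : ℝ))
  | .sinPi e => Real.sin (Real.pi / (e.eval s : ℝ))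

/-- The cost of evaluating a real expression: the number of its nodes. -/
def RExp.cost : RExp → ℕ
  | .const _ => 1
  | .reg _ => 1
  | .load e => e.cost + 1
  | .add e f => e.cost + f.cost + 1
  | .sub e f => e.cost + f.cost + 1
  | .mul e f => e.cost + f.cost + 1
  | .div e f => e.cost + f.cost + 1
  | .sqrt e => e.cost + 1
  | .cosPi e => e.cost + 1
  | .sinPi e => e.cost + 1

/-- The truth of a test. -/
def BExp.holds (s : State) : BExp → Prop
  | .nle e f => e.eval s ≤ f.eval s
  | .rle e f => e.eval s ≤ f.eval s
  | .not b => ¬ b.holds s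

/-- The cost of a test. -/
def BExp.cost : BExp → ℕ
  | .nle e f => e.cost + f.cost + 1
  | .rle e f => e.cost + f.cost + 1
  | .not b => b.cost + 1

/-- `Exec procs c s t s'`: with the procedures `procs`, the command `c` started in state `s`
halts in state `s'` after exactly `t` steps. -/
inductive Exec (procs : List Cmd) : Cmd → State → ℕ → State → Prop
  | skip (s : State) : Exec procs .skip s 1 s
  | setN (s : State) (x : ℕ) (e : NExp) :
      Exec procs (.setN x e) s (e.cost + 1)
        { s with nreg := Function.update s.nreg x (e.eval s) }
  | storeN (s : State) (a e : NExp) :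
      Exec procs (.storeN a e) s (a.cost + e.cost + 1)
        { s with nmem := Function.update s.nmem (a.eval s) (e.eval s) }
  | setR (s : State) (x : ℕ) (e : RExp) :
      Exec procs (.setR x e) s (e.cost + 1)
        { s with rreg := Function.update s.rreg x (e.eval s) }
  | storeR (s : State) (a : NExp) (e : RExp) :
      Exec procs (.storeR a e) s (a.cost + e.cost + 1)
        { s with rmem := Function.update s.rmem (a.eval s) (e.eval s) }
  | seq {c d : Cmd} {s s' s'' : State} {t t' : ℕ}
      (hc : Exec procs c s t s') (hd : Exec procs d s' t' s'') :
      Exec procs (.seq c d) s (t + t') s''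
  | ite_true {b : BExp} {c d : Cmd} {s s' : State} {t : ℕ}
      (hb : b.holds s) (hc : Exec procs c s t s') :
      Exec procs (.ite b c d) s (b.cost + t + 1) s'
  | ite_false {b : BExp} {c d : Cmd} {s s' : State} {t : ℕ}
      (hb : ¬ b.holds s) (hd : Exec procs d s t s') :
      Exec procs (.ite b c d) s (b.cost + t + 1) s'
  | while_true {b : BExp} {c : Cmd} {s s' s'' : State} {t t' : ℕ}
      (hb : b.holds s) (hc : Exec procs c s t s') (hw : Exec procs (.while b c) s' t' s'') :
      Exec procs (.while b c) s (b.cost + t + t' + 1) s''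
  | while_false {b : BExp} {c : Cmd} {s : State} (hb : ¬ b.holds s) :
      Exec procs (.while b c) s (b.cost + 1) s
  | call {i : ℕ} {c : Cmd} {s s' : State} {t : ℕ}
      (hi : procs[i]? = some c) (hc : Exec procs c s t s') :
      Exec procs (.call i) s (t + 1) s'

/-- `P.HaltsIn s t s'`: the program `P` started in `s` halts in `s'` after exactly `t` steps. -/
def Program.HaltsIn (P : Program) (s : State) (t : ℕ) (s' : State) : Prop :=
  Exec P.procs P.main s t s'

/-- The initial state: `n` is in natural-number register `0`, the entries of `b` are in cells
`0, …, m - 1` of the real memory, and everything else is `0`. -/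
def inputState {m : ℕ} (n : ℕ) (b : Fin m → ℝ) : State where
  nreg := fun x => if x = 0 then n else 0
  nmem := fun _ => 0
  rreg := fun _ => 0
  rmem := fun a => if h : a < m then b ⟨a, h⟩ else 0

end RealRAM

/-!
With `ζ = exp (π i / n)`, the circulant matrix extending the prefix sums has the eigenvalues
`σ = n` at frequency `0`, `σ = 0` at the other even frequencies and `σ = 2 / (1 - ζ⁻ᵏ)` at the odd
frequencies `k`. On the odd frequencies the encoder is an invertible negacyclic convolution, and
frequency `0` adds a single row to it. The least-squares solution is therefore `y + λ u`, where `y`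
inverts the convolution and `u` accounts for the rank-one change of the normal equations: its
transform is `σ / |σ|` at the odd frequencies, so that `|σ| û = σ`, and its entries are the numbers
`1 / (n sin (π (2 m + 1) / (2 n)))`. The decoder returns the partial sums of `y + λ u`.

The vector `y` costs a transform to the odd frequencies and one back. Bluestein's identity
`2 i j = i ^ 2 + j ^ 2 - (i - j) ^ 2` makes each of them a convolution, read off a product of
polynomials modulo `X ^ 2 ^ k - i`. Such a product is computed in place by splitting
`X ^ (2 m) - c = (X ^ m - √c) (X ^ m + √c)`; this recursion needs no stack, since squaring recovers
`c` from `√c`, and it takes time `O(N log N)` for `N = 2 ^ k`, with `2 ^ k < 6 n`.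
-/

namespace FFTMech

open Finset
open scoped ComplexConjugate

open scoped ComplexOrder in
theorem pinv_mulVec_eq {m n : Type*} [Fintype m] [Fintype n] {A : Matrix m n ℂ} {x : n → ℂ}
    {b : m → ℂ} (hA : ∀ v, A *ᵥ v = 0 → v = 0) (hx : Aᴴ *ᵥ (A *ᵥ x) = Aᴴ *ᵥ b) :
    pinv A *ᵥ b = x := by
  have hpinv := pinv_spec A
  have h_adj : Aᴴ * (A * pinv A) = Aᴴ := by
    rw [← hpinv.isHermitian_left.eq, ← conjTranspose_mul, hpinv.mul_mul_self]
  have h_normal : (Aᴴ * A) *ᵥ (pinv A *ᵥ b - x) = 0 := by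
    rw [mulVec_sub, mulVec_mulVec, Matrix.mul_assoc, h_adj, ← mulVec_mulVec, hx, sub_self]
  rw [conjTranspose_mul_self_mulVec_eq_zero] at h_normal
  exact sub_eq_zero.1 (hA _ h_normal)

/-! ### Square roots -/

/-- The square root that the machine computes with real operations. It is the principal square root
away from the negative real axis, where the division by zero spoils it. -/
noncomputable def csqrt (z : ℂ) : ℂ :=
  ⟨√((‖z‖ + z.re) / 2), z.im / (2 * √((‖z‖ + z.re) / 2))⟩

theorem sqrt_mul_self (z : ℂ) : Complex.sqrt z * Complex.sqrt z = z := by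
  rw [← sq]
  exact_mod_cast Complex.cpow_nat_inv_pow z two_ne_zero

theorem csqrt_eq_sqrt {z : ℂ} (hz : z ∈ Complex.slitPlane) : csqrt z = Complex.sqrt z := by
  have hre : (Complex.sqrt z).re = √((‖z‖ + z.re) / 2) := Complex.cpow_inv_two_re z
  have hpos : 0 < √((‖z‖ + z.re) / 2) := by
    refine Real.sqrt_pos.2 (half_pos ?_)
    rcases Complex.mem_slitPlane_iff.1 hz with h | h
    · exact add_pos_of_nonneg_of_pos (norm_nonneg z) h
    · linarith [neg_abs_le z.re, Complex.abs_re_lt_norm.2 h]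
  have him := congrArg Complex.im (sqrt_mul_self z)
  rw [Complex.mul_im, hre] at him
  refine Complex.ext hre.symm ?_
  rw [csqrt, ← him]
  field_simp
  ring

theorem csqrt_mul_self {z : ℂ} (hz : z ∈ Complex.slitPlane) : csqrt z * csqrt z = z := by
  rw [csqrt_eq_sqrt hz, sqrt_mul_self]

theorem csqrt_im_ne_zero {z : ℂ} (hz : z.im ≠ 0) : (csqrt z).im ≠ 0 := by
  intro h
  have him := congrArg Complex.im (csqrt_mul_self (Complex.mem_slitPlane_iff.2 (.inr hz)))
  rw [Complex.mul_im, h, mul_zero, zero_mul, add_zero] at him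
  exact hz him.symm

theorem csqrt_conj (z : ℂ) : csqrt (conj z) = conj (csqrt z) := by
  apply Complex.ext <;> simp [csqrt, neg_div]

theorem csqrt_natCast (n : ℕ) : csqrt n = (√n : ℝ) := by
  apply Complex.ext <;> simp [csqrt]

theorem re_lt_one_of_norm_eq_one {z : ℂ} (hz : ‖z‖ = 1) (h1 : z ≠ 1) : z.re < 1 := by
  refine lt_of_le_of_ne (hz ▸ Complex.re_le_norm z) fun hre => h1 (Complex.ext hre ?_)
  by_contra him
  have := Complex.abs_re_lt_norm.2 him
  rw [hre, hz, abs_one] at this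
  exact this.false

/-! ### Roots of unity and orthogonality -/

/-- The root of unity `exp (π i / N)`, of order `2N`. -/
noncomputable def zeta (N : ℕ) : ℂ := Complex.exp (Real.pi / (N : ℂ) * Complex.I)

theorem zeta_ne_zero (N : ℕ) : zeta N ≠ 0 := Complex.exp_ne_zero _

theorem zeta_pow_eq_exp (N k : ℕ) :
    zeta N ^ k = Complex.exp (((Real.pi * k / N : ℝ) : ℂ) * Complex.I) := by
  rw [zeta, ← Complex.exp_nat_mul]
  congr 1
  push_cast
  ring

theorem norm_zeta_pow (N k : ℕ) : ‖zeta N ^ k‖ = 1 := by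
  rw [zeta_pow_eq_exp, Complex.norm_exp_ofReal_mul_I]

theorem conj_zeta_pow (N k : ℕ) : conj (zeta N ^ k) = (zeta N ^ k)⁻¹ :=
  (Complex.inv_eq_conj (norm_zeta_pow N k)).symm

theorem zeta_sub_inv_zeta (N k : ℕ) :
    zeta N ^ k - (zeta N ^ k)⁻¹ = 2 * Complex.I * (zeta N ^ k).im := by
  rw [← conj_zeta_pow, Complex.sub_conj]
  push_cast
  ring

theorem im_zeta_pow_pos {N k : ℕ} (hk : 0 < k) (hkN : k < N) : 0 < (zeta N ^ k).im := by
  rw [zeta_pow_eq_exp, Complex.exp_ofReal_mul_I_im]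
  have hN : (0 : ℝ) < N := by exact_mod_cast hk.trans hkN
  apply Real.sin_pos_of_pos_of_lt_pi
  · positivity
  · rw [div_lt_iff₀ hN]
    gcongr

theorem zeta_two_mul_sq (N : ℕ) : zeta (2 * N) ^ 2 = zeta N := by
  rw [zeta_pow_eq_exp, ← pow_one (zeta N), zeta_pow_eq_exp]
  congr 3
  push_cast
  rw [mul_comm Real.pi, mul_div_mul_left _ _ two_ne_zero, mul_one]

theorem isPrimitiveRoot_zeta {N : ℕ} (hN : 0 < N) : IsPrimitiveRoot (zeta N) (2 * N) := by
  have h := Complex.isPrimitiveRoot_exp (2 * N) (by lia)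
  have hN' : (N : ℂ) ≠ 0 := by exact_mod_cast hN.ne'
  convert h using 1
  rw [zeta]
  congr 1
  push_cast
  field_simp

theorem zeta_pow_self {N : ℕ} (hN : 0 < N) : zeta N ^ N = -1 := by
  have hN' : (N : ℝ) ≠ 0 := by positivity
  rw [zeta_pow_eq_exp, mul_div_cancel_right₀ _ hN', Complex.exp_pi_mul_I]

theorem zeta_pow_odd_mul_self {N : ℕ} (hN : 0 < N) (j : ℕ) :
    zeta N ^ ((2 * j + 1) * N) = -1 := by
  rw [mul_comm, pow_mul, zeta_pow_self hN, Odd.neg_one_pow ⟨j, rfl⟩]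

theorem zeta_pow_odd_ne_one {N : ℕ} (hN : 0 < N) (j : ℕ) : zeta N ^ (2 * j + 1) ≠ 1 := by
  intro h
  obtain ⟨c, hc⟩ := ((isPrimitiveRoot_zeta hN).pow_eq_one_iff_dvd _).1 h
  rw [Nat.mul_assoc] at hc
  lia

theorem conj_zeta_pow_odd {N j : ℕ} (hj : j < N) :
    conj (zeta N ^ (2 * j + 1)) = zeta N ^ (2 * (N - 1 - j) + 1) := by
  rw [conj_zeta_pow]
  refine inv_eq_of_mul_eq_one_right ?_
  rw [← pow_add, show 2 * j + 1 + (2 * (N - 1 - j) + 1) = 2 * N by lia,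
    (isPrimitiveRoot_zeta (by lia)).pow_eq_one]

theorem sum_pow_mul_inv_pow {K : Type*} [Field K] [DecidableEq K] {x y : K} {n : ℕ} (hy : y ≠ 0)
    (hxy : x ^ n = y ^ n) :
    ∑ j ∈ range n, x ^ j * (y ^ j)⁻¹ = if x = y then (n : K) else 0 := by
  simp only [← div_eq_mul_inv, ← div_pow]
  split_ifs with h
  · simp [h, div_self hy]
  · rw [geom_sum_eq (by rwa [ne_eq, div_eq_one_iff_eq hy]), div_pow, hxy,
      div_self (pow_ne_zero _ hy), sub_self, zero_div]

theorem sum_zeta_pow_mul_inv {N : ℕ} (hN : 0 < N) {k l : ℕ} (hk : k < 2 * N) (hl : l < 2 * N) :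
    ∑ a ∈ range (2 * N), zeta N ^ (k * a) * (zeta N ^ (l * a))⁻¹
      = if k = l then ((2 * N : ℕ) : ℂ) else 0 := by
  have hζ := isPrimitiveRoot_zeta hN
  have h_period (i : ℕ) : (zeta N ^ i) ^ (2 * N) = 1 := by
    rw [← pow_mul, mul_comm, pow_mul, hζ.pow_eq_one, one_pow]
  simp only [pow_mul]
  rw [sum_pow_mul_inv_pow (pow_ne_zero _ (zeta_ne_zero N)) ((h_period k).trans (h_period l).symm)]
  exact if_congr ⟨hζ.pow_inj hk hl, congrArg _⟩ rfl rfl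

theorem sum_zeta_pow_odd_mul_inv {N : ℕ} (hN : 0 < N) {i j : ℕ} (hi : i < N) (hj : j < N) :
    ∑ m ∈ range N, zeta N ^ ((2 * i + 1) * m) * (zeta N ^ ((2 * j + 1) * m))⁻¹
      = if i = j then (N : ℂ) else 0 := by
  simp only [pow_mul]
  rw [sum_pow_mul_inv_pow (pow_ne_zero _ (zeta_ne_zero N)) (by
    rw [← pow_mul, ← pow_mul, zeta_pow_odd_mul_self hN, zeta_pow_odd_mul_self hN])]
  refine if_congr ⟨fun h => ?_, fun h => by rw [h]⟩ rfl rfl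
  have := (isPrimitiveRoot_zeta hN).pow_inj (by lia) (by lia) h
  lia

theorem sum_odd_zeta_pow_mul_inv {N : ℕ} (hN : 0 < N) {m a : ℕ} (hm : m < N) (ha : a < N) :
    ∑ j ∈ range N, zeta N ^ ((2 * j + 1) * m) * (zeta N ^ ((2 * j + 1) * a))⁻¹
      = if m = a then (N : ℂ) else 0 := by
  have hζ := isPrimitiveRoot_zeta hN
  have hne := zeta_ne_zero N
  have h_period (i : ℕ) : (zeta N ^ (2 * i)) ^ N = 1 := by
    rw [← pow_mul, mul_right_comm, pow_mul, hζ.pow_eq_one, one_pow]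
  have h_term (j : ℕ) : zeta N ^ ((2 * j + 1) * m) * (zeta N ^ ((2 * j + 1) * a))⁻¹
      = zeta N ^ m * (zeta N ^ a)⁻¹ * ((zeta N ^ (2 * m)) ^ j * ((zeta N ^ (2 * a)) ^ j)⁻¹) := by
    field_simp
    ring
  simp only [h_term, ← mul_sum]
  rw [sum_pow_mul_inv_pow (pow_ne_zero _ hne) ((h_period m).trans (h_period a).symm)]
  rcases eq_or_ne m a with rfl | hma
  · simp [hne]
  · rw [if_neg hma, if_neg fun h => hma ?_, mul_zero]
    have := hζ.pow_inj (by lia) (by lia) h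
    lia

/-! ### The transform on odd frequencies -/

/-- The unnormalized discrete Fourier transform of size `2n` of `(x 0, …, x (m - 1), 0, …)` at
frequency `k`. -/
noncomputable def dft (n m : ℕ) (x : ℕ → ℂ) (k : ℕ) : ℂ :=
  ∑ a ∈ range m, x a * (zeta n ^ (k * a))⁻¹

/-- The negacyclic inverse transform: recovers `x 0, …, x (n - 1)` from the values of their `dft`
at the odd frequencies `1, 3, …, 2n - 1`. -/
noncomputable def oddInvDFT (n : ℕ) (y : ℕ → ℂ) (m : ℕ) : ℂ :=
  (∑ j ∈ range n, y j * zeta n ^ ((2 * j + 1) * m)) / n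

theorem dft_add_mul (n m : ℕ) (x y : ℕ → ℂ) (c : ℂ) (k : ℕ) :
    dft n m (fun a => x a + c * y a) k = dft n m x k + c * dft n m y k := by
  simp only [dft, mul_sum, ← sum_add_distrib]
  exact sum_congr rfl fun a _ => by ring

theorem dft_zero_right (n m : ℕ) (x : ℕ → ℂ) : dft n m x 0 = ∑ a ∈ range m, x a := by
  simp [dft]

theorem dft_two_mul_odd {n : ℕ} (hn : 0 < n) (b : ℕ → ℂ) (j : ℕ) :
    dft n (2 * n) b (2 * j + 1) = dft n n (fun a => b a - b (n + a)) (2 * j + 1) := by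
  simp only [dft]
  rw [two_mul n, sum_range_add, ← sum_add_distrib]
  refine sum_congr rfl fun a _ => ?_
  rw [mul_add, pow_add, zeta_pow_odd_mul_self hn, neg_one_mul, inv_neg]
  ring

theorem dft_oddInvDFT {n : ℕ} (y : ℕ → ℂ) {j : ℕ} (hj : j < n) :
    dft n n (oddInvDFT n y) (2 * j + 1) = y j := by
  have hn : (n : ℂ) ≠ 0 := by exact_mod_cast (by lia : n ≠ 0)
  calc dft n n (oddInvDFT n y) (2 * j + 1)
      = ∑ m ∈ range n, ∑ i ∈ range n, y i / n *
          (zeta n ^ ((2 * i + 1) * m) * (zeta n ^ ((2 * j + 1) * m))⁻¹) := by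
        refine sum_congr rfl fun m _ => ?_
        rw [oddInvDFT, sum_div, sum_mul]
        exact sum_congr rfl fun i _ => by ring
    _ = ∑ i ∈ range n, y i / n * if i = j then (n : ℂ) else 0 := by
        rw [sum_comm]
        refine sum_congr rfl fun i hi => ?_
        rw [← mul_sum, sum_zeta_pow_odd_mul_inv (by lia) (mem_range.1 hi) hj]
    _ = y j := by simp [hj, hn]

theorem oddInvDFT_dft {n : ℕ} (x : ℕ → ℂ) {m : ℕ} (hm : m < n) :
    oddInvDFT n (fun j => dft n n x (2 * j + 1)) m = x m := by
  have hn : (n : ℂ) ≠ 0 := by exact_mod_cast (by lia : n ≠ 0)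
  rw [oddInvDFT, div_eq_iff hn]
  calc ∑ j ∈ range n, dft n n x (2 * j + 1) * zeta n ^ ((2 * j + 1) * m)
      = ∑ j ∈ range n, ∑ a ∈ range n, x a *
          (zeta n ^ ((2 * j + 1) * m) * (zeta n ^ ((2 * j + 1) * a))⁻¹) := by
        refine sum_congr rfl fun j _ => ?_
        rw [dft, sum_mul]
        exact sum_congr rfl fun a _ => by ring
    _ = ∑ a ∈ range n, x a * if m = a then (n : ℂ) else 0 := by
        rw [sum_comm]
        refine sum_congr rfl fun a ha => ?_
        rw [← mul_sum, sum_odd_zeta_pow_mul_inv (by lia) hm (mem_range.1 ha)]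
    _ = x m * n := by simp [hm]

theorem conj_dft_odd {n j : ℕ} (hj : j < n) {m : ℕ} {x : ℕ → ℂ} (hx : ∀ a, conj (x a) = x a) :
    conj (dft n m x (2 * j + 1)) = dft n m x (2 * (n - 1 - j) + 1) := by
  simp only [dft, map_sum, map_mul, map_inv₀, hx, pow_mul, map_pow, conj_zeta_pow_odd hj]

theorem conj_oddInvDFT {n : ℕ} {y : ℕ → ℂ} (hy : ∀ j < n, conj (y j) = y (n - 1 - j)) (m : ℕ) :
    conj (oddInvDFT n y m) = oddInvDFT n y m := by
  rw [oddInvDFT, map_div₀, map_sum, Complex.conj_natCast, ← sum_range_reflect (fun j => y j * _)]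
  congr 1
  refine sum_congr rfl fun j hj => ?_
  rw [map_mul, hy j (mem_range.1 hj), pow_mul, pow_mul, map_pow, conj_zeta_pow_odd (mem_range.1 hj)]

end FFTMech

namespace FFTMech

open Finset
open scoped ComplexConjugate

/-! ### Eigenvalues -/

/-- The eigenvalue at frequency `k` of the circulant matrix that extends the prefix sums. -/
noncomputable def eig (n k : ℕ) : ℂ := dft n n (fun _ => 1) k

theorem eig_zero (n : ℕ) : eig n 0 = n := by simp [eig, dft_zero_right]

theorem eig_even {n j : ℕ} (h0 : 0 < j) (hj : j < n) : eig n (2 * j) = 0 := by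
  have hζ := isPrimitiveRoot_zeta (h0.trans hj)
  have hne : (zeta n ^ (2 * j))⁻¹ ≠ 1 := by
    rw [inv_ne_one, ne_eq, hζ.pow_eq_one_iff_dvd]
    exact Nat.not_dvd_of_pos_of_lt (by lia) (by lia)
  have h_pow (a : ℕ) : (zeta n ^ (2 * j * a))⁻¹ = ((zeta n ^ (2 * j))⁻¹) ^ a := by
    rw [inv_pow, pow_mul]
  simp only [eig, dft, one_mul, h_pow]
  rw [geom_sum_eq hne, inv_pow, ← pow_mul, mul_right_comm, pow_mul, hζ.pow_eq_one, one_pow,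
    inv_one, sub_self, zero_div]

theorem inv_eig_odd {n : ℕ} (hn : 0 < n) (j : ℕ) :
    (eig n (2 * j + 1))⁻¹ = (1 - conj (zeta n ^ (2 * j + 1))) / 2 := by
  have hne : (zeta n ^ (2 * j + 1))⁻¹ ≠ 1 := inv_ne_one.2 (zeta_pow_odd_ne_one hn j)
  have h_pow (a : ℕ) : (zeta n ^ ((2 * j + 1) * a))⁻¹ = ((zeta n ^ (2 * j + 1))⁻¹) ^ a := by
    rw [inv_pow, pow_mul]
  simp only [eig, dft, one_mul, h_pow]
  rw [conj_zeta_pow, geom_sum_eq hne, inv_pow, ← pow_mul, zeta_pow_odd_mul_self hn, inv_div,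
    ← neg_div_neg_eq]
  norm_num

theorem re_inv_eig_odd_pos {n : ℕ} (hn : 0 < n) (j : ℕ) : 0 < ((eig n (2 * j + 1))⁻¹).re := by
  have := re_lt_one_of_norm_eq_one (norm_zeta_pow n (2 * j + 1)) (zeta_pow_odd_ne_one hn j)
  rw [inv_eig_odd hn]
  simp only [Complex.div_ofNat_re, Complex.sub_re, Complex.one_re, Complex.conj_re]
  linarith

theorem eig_odd_eq {n j : ℕ} (hj : j < n) :
    eig n (2 * j + 1)
      = -Complex.I * zeta (2 * n) ^ (2 * j + 1) / (zeta (2 * n) ^ (2 * j + 1)).im := by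
  have h_sub := zeta_sub_inv_zeta (2 * n) (2 * j + 1)
  have h_inv := inv_eig_odd (Nat.zero_lt_of_lt hj) j
  have hz := pow_ne_zero (2 * j + 1) (zeta_ne_zero (2 * n))
  rw [conj_zeta_pow, ← zeta_two_mul_sq n, pow_right_comm] at h_inv
  generalize zeta (2 * n) ^ (2 * j + 1) = z at *
  have h_im : (z.im : ℂ) * Complex.I = (z - z⁻¹) / 2 := by rw [h_sub]; ring
  rw [← _root_.inv_inj, h_inv, inv_div, div_eq_mul_inv (z.im : ℂ), mul_inv, inv_neg, Complex.inv_I,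
    neg_neg, ← mul_assoc, h_im]
  field_simp

theorem conj_sqrt_mul_sqrt (z : ℂ) : conj (Complex.sqrt z) * Complex.sqrt z = ‖z‖ := by
  rw [Complex.conj_mul', ← Complex.ofReal_pow, sq, ← norm_mul, sqrt_mul_self]

/-- The reciprocal square root of the eigenvalue at frequency `2j + 1`. -/
noncomputable def invSqrtEig (n j : ℕ) : ℂ := csqrt ((1 - conj (zeta n ^ (2 * j + 1))) / 2)

theorem sqrt_eig_mul_invSqrtEig {n : ℕ} (hn : 0 < n) (j : ℕ) :
    Complex.sqrt (eig n (2 * j + 1)) * invSqrtEig n j = 1 := by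
  have hpos := re_inv_eig_odd_pos hn j
  have h_slit : (eig n (2 * j + 1))⁻¹ ∈ Complex.slitPlane := .inl hpos
  have hne : eig n (2 * j + 1) ≠ 0 := by
    intro h
    simp [h] at hpos
  have h_inv := Complex.inv_cpow _ (2⁻¹ : ℂ) (Complex.slitPlane_arg_ne_pi h_slit)
  rw [inv_inv] at h_inv
  rw [invSqrtEig, ← inv_eig_odd hn, csqrt_eq_sqrt h_slit, Complex.sqrt, Complex.sqrt, h_inv,
    inv_mul_cancel₀]
  exact Complex.cpow_ne_zero_iff.2 (.inl (inv_ne_zero hne))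

theorem conj_invSqrtEig {n j : ℕ} (hj : j < n) :
    conj (invSqrtEig n j) = invSqrtEig n (n - 1 - j) := by
  rw [invSqrtEig, invSqrtEig, ← csqrt_conj, ← conj_zeta_pow_odd hj, map_div₀, map_sub, map_one,
    Complex.conj_ofNat]

/-! ### The least-squares solution -/

/-- The preimage of `d` under the negacyclic convolution by which the encoder acts on the odd
frequencies. -/
noncomputable def negacyclicSol (n : ℕ) (d : ℕ → ℂ) : ℕ → ℂ :=
  oddInvDFT n fun j => invSqrtEig n j * dft n n d (2 * j + 1)

/-- The direction `u` of the rank-one correction: `û = σ / |σ|` at every odd frequency, where `σ` is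
the eigenvalue. -/
noncomputable def correction (n : ℕ) : ℕ → ℂ :=
  oddInvDFT n fun j => -Complex.I * zeta (2 * n) ^ (2 * j + 1)

/-- The reduction of `b` modulo `X ^ n + 1`. -/
def negacyclicFold (n : ℕ) (b : ℕ → ℂ) (a : ℕ) : ℂ := b a - b (n + a)

/-- The coefficient of the rank-one correction, which makes the residual at frequency `0`
compensate the residuals at the odd frequencies. -/
noncomputable def correctionCoeff (n : ℕ) (b : ℕ → ℂ) : ℂ :=
  ((∑ a ∈ range (2 * n), b a) / csqrt n - ∑ j ∈ range n, negacyclicSol n (negacyclicFold n b) j) /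
    (1 + ∑ j ∈ range n, correction n j)

/-- The solution of the least-squares problem for the encoder. -/
noncomputable def leastSquares (n : ℕ) (b : ℕ → ℂ) (m : ℕ) : ℂ :=
  negacyclicSol n (negacyclicFold n b) m + correctionCoeff n b * correction n m

theorem correction_eq {n m : ℕ} (hm : m < n) :
    correction n m = 1 / (n * (zeta (2 * n) ^ (2 * m + 1)).im) := by
  have h_im : ((zeta (2 * n) ^ (2 * m + 1)).im : ℂ) ≠ 0 := by
    exact_mod_cast (im_zeta_pow_pos (by lia) (by lia)).ne'
  have hz := pow_ne_zero (2 * m + 1) (zeta_ne_zero (2 * n))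
  have h_sub := zeta_sub_inv_zeta (2 * n) (2 * m + 1)
  have h_pow : (zeta (2 * n) ^ (2 * m + 1)) ^ (2 * n) = -1 := by
    rw [← pow_mul, zeta_pow_odd_mul_self (by lia)]
  have h_term (j : ℕ) : -Complex.I * zeta (2 * n) ^ (2 * j + 1) * zeta n ^ ((2 * j + 1) * m)
      = -Complex.I * zeta (2 * n) ^ (2 * m + 1) * ((zeta (2 * n) ^ (2 * m + 1)) ^ 2) ^ j := by
    rw [← zeta_two_mul_sq n]
    ring
  simp only [correction, oddInvDFT, h_term, ← mul_sum]
  generalize zeta (2 * n) ^ (2 * m + 1) = z at *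
  have h_sq : z ^ 2 - 1 = z * (2 * Complex.I * z.im) := by
    rw [← h_sub]
    field_simp
  have h_ne : z ^ 2 ≠ 1 := by
    rw [← sub_ne_zero, h_sq]
    exact mul_ne_zero hz (mul_ne_zero (mul_ne_zero two_ne_zero Complex.I_ne_zero) h_im)
  have hI := Complex.I_ne_zero
  rw [geom_sum_eq h_ne, ← pow_mul, h_pow, h_sq]
  field_simp
  ring

theorem conj_correction {n m : ℕ} (hm : m < n) : conj (correction n m) = correction n m := by
  simp [correction_eq hm]

theorem one_add_sum_correction_ne_zero (n : ℕ) : 1 + ∑ j ∈ range n, correction n j ≠ 0 := by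
  have h_ofReal : 1 + ∑ j ∈ range n, correction n j
      = ((1 + ∑ j ∈ range n, 1 / (n * (zeta (2 * n) ^ (2 * j + 1)).im) : ℝ) : ℂ) := by
    push_cast
    exact congrArg _ (sum_congr rfl fun j hj => correction_eq (mem_range.1 hj))
  rw [h_ofReal, Complex.ofReal_ne_zero]
  refine (add_pos_of_pos_of_nonneg one_pos (sum_nonneg fun j hj => ?_)).ne'
  have hj := mem_range.1 hj
  have := im_zeta_pow_pos (N := 2 * n) (k := 2 * j + 1) (by lia) (by lia)
  positivity

theorem norm_eig_mul_dft_correction {n j : ℕ} (hj : j < n) :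
    ‖eig n (2 * j + 1)‖ * dft n n (correction n) (2 * j + 1) = eig n (2 * j + 1) := by
  have hpos := im_zeta_pow_pos (N := 2 * n) (k := 2 * j + 1) (by lia) (by lia)
  rw [correction, dft_oddInvDFT _ hj, eig_odd_eq hj, norm_div, norm_mul, norm_zeta_pow, norm_neg,
    Complex.norm_I, Complex.norm_real, Real.norm_of_nonneg hpos.le]
  push_cast
  ring

theorem leastSquares_residual_zero {n : ℕ} (hn : 0 < n) (b : ℕ → ℂ) :
    conj (Complex.sqrt (eig n 0)) * (Complex.sqrt (eig n 0) * dft n n (leastSquares n b) 0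
      - dft n (2 * n) b 0) = -(n * correctionCoeff n b) := by
  have h_slit : (n : ℂ) ∈ Complex.slitPlane := .inl (by simpa using hn)
  have h_sq : csqrt n * csqrt n = n := csqrt_mul_self h_slit
  have h_ne : csqrt n ≠ 0 := by
    intro h
    rw [h, mul_zero] at h_sq
    exact hn.ne (by exact_mod_cast h_sq)
  have h_conj : conj (csqrt n) = csqrt n := by rw [csqrt_natCast, Complex.conj_ofReal]
  have h_coeff : correctionCoeff n b + correctionCoeff n b * ∑ j ∈ range n, correction n j
      = (∑ a ∈ range (2 * n), b a) / csqrt n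
        - ∑ j ∈ range n, negacyclicSol n (negacyclicFold n b) j := by
    rw [← mul_one_add, correctionCoeff, div_mul_cancel₀ _ (one_add_sum_correction_ne_zero n)]
  rw [eig_zero, ← csqrt_eq_sqrt h_slit, h_conj, dft_zero_right, dft_zero_right]
  simp only [leastSquares]
  rw [sum_add_distrib, ← mul_sum, eq_sub_of_add_eq' h_coeff]
  linear_combination -correctionCoeff n b * h_sq +
    csqrt n * mul_div_cancel₀ (∑ a ∈ range (2 * n), b a) h_ne

theorem leastSquares_residual_odd {n : ℕ} (b : ℕ → ℂ) {j : ℕ} (hj : j < n) :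
    conj (Complex.sqrt (eig n (2 * j + 1))) * (Complex.sqrt (eig n (2 * j + 1)) *
      dft n n (leastSquares n b) (2 * j + 1) - dft n (2 * n) b (2 * j + 1))
      = correctionCoeff n b * eig n (2 * j + 1) := by
  have hn := Nat.zero_lt_of_lt hj
  have h_inv := sqrt_eig_mul_invSqrtEig hn j
  have h_norm := norm_eig_mul_dft_correction hj
  have h_dft : dft n n (leastSquares n b) (2 * j + 1)
      = invSqrtEig n j * dft n n (negacyclicFold n b) (2 * j + 1)
        + correctionCoeff n b * dft n n (correction n) (2 * j + 1) := by
    rw [← dft_oddInvDFT (fun j => invSqrtEig n j * dft n n (negacyclicFold n b) (2 * j + 1)) hj]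
    exact dft_add_mul n n _ _ _ _
  have h_fold : dft n (2 * n) b (2 * j + 1) = dft n n (negacyclicFold n b) (2 * j + 1) :=
    dft_two_mul_odd hn b j
  rw [← conj_sqrt_mul_sqrt] at h_norm
  rw [h_dft, h_fold]
  linear_combination correctionCoeff n b * h_norm + conj (Complex.sqrt (eig n (2 * j + 1))) *
    dft n n (negacyclicFold n b) (2 * j + 1) * h_inv

theorem sum_range_two_mul {M : Type*} [AddCommMonoid M] (f : ℕ → M) (n : ℕ) :
    ∑ k ∈ range (2 * n), f k = ∑ j ∈ range n, f (2 * j) + ∑ j ∈ range n, f (2 * j + 1) := by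
  induction n with
  | zero => simp
  | succ n ih =>
    rw [mul_add, mul_one, sum_range_succ, sum_range_succ, ih, sum_range_succ, sum_range_succ]
    abel

theorem leastSquares_normal {n : ℕ} (b : ℕ → ℂ) {m : ℕ} (hm : m < n) :
    ∑ k ∈ range (2 * n), conj (Complex.sqrt (eig n k)) * (Complex.sqrt (eig n k) *
      dft n n (leastSquares n b) k - dft n (2 * n) b k) * zeta n ^ (k * m) = 0 := by
  have hn := Nat.zero_lt_of_lt hm
  have hn' : (n : ℂ) ≠ 0 := by exact_mod_cast hn.ne'
  have h_even : ∑ j ∈ range n, conj (Complex.sqrt (eig n (2 * j))) * (Complex.sqrt (eig n (2 * j)) *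
      dft n n (leastSquares n b) (2 * j) - dft n (2 * n) b (2 * j)) * zeta n ^ (2 * j * m)
      = -(n * correctionCoeff n b) := by
    rw [sum_eq_single_of_mem 0 (mem_range.2 hn) fun j hj h0 => ?_]
    · rw [mul_zero, zero_mul, pow_zero, mul_one, leastSquares_residual_zero hn]
    · simp [eig_even (Nat.pos_of_ne_zero h0) (mem_range.1 hj)]
  have h_eig : ∑ j ∈ range n, eig n (2 * j + 1) * zeta n ^ ((2 * j + 1) * m) = n := by
    have := oddInvDFT_dft (fun _ => 1) hm
    rwa [oddInvDFT, div_eq_one_iff_eq hn'] at this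
  rw [sum_range_two_mul, h_even, sum_congr rfl fun j hj => by
    rw [leastSquares_residual_odd b (mem_range.1 hj), mul_assoc], ← mul_sum, h_eig]
  ring

theorem conj_negacyclicSol {n : ℕ} {d : ℕ → ℂ} (hd : ∀ a, conj (d a) = d a) (m : ℕ) :
    conj (negacyclicSol n d m) = negacyclicSol n d m :=
  conj_oddInvDFT (fun j hj => by rw [map_mul, conj_invSqrtEig hj, conj_dft_odd hj hd]) m

theorem conj_leastSquares {n : ℕ} (b : ℕ → ℝ) {m : ℕ} (hm : m < n) :
    conj (leastSquares n (fun a => b a) m) = leastSquares n (fun a => b a) m := by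
  have h_sol := conj_negacyclicSol (n := n) (d := negacyclicFold n fun a => b a) fun a => by
    simp [negacyclicFold]
  have h_sum : ∑ j ∈ range n, conj (correction n j) = ∑ j ∈ range n, correction n j :=
    sum_congr rfl fun j hj => conj_correction (mem_range.1 hj)
  simp only [leastSquares, correctionCoeff, map_add, map_mul, map_div₀, map_sub, map_one, map_sum,
    h_sol, conj_correction hm, csqrt_natCast, Complex.conj_ofReal, h_sum]

/-! ### The encoder -/

theorem exp_eq_inv_zeta_pow (n k a : ℕ) :
    Complex.exp (-(2 * Real.pi * Complex.I * (k : ℂ) * (a : ℂ) / ((2 * n : ℕ) : ℂ)))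
      = (zeta n ^ (k * a))⁻¹ := by
  rw [zeta_pow_eq_exp, ← Complex.exp_neg]
  congr 1
  push_cast
  rw [mul_assoc 2, mul_assoc 2, mul_assoc 2, mul_div_mul_left _ _ two_ne_zero]
  ring

theorem dftMatrix_apply (n : ℕ) (k a : Fin (2 * n)) :
    dftMatrix (2 * n) k a = ((√(2 * n : ℕ) : ℝ) : ℂ)⁻¹ * (zeta n ^ (k * a : ℕ))⁻¹ := by
  rw [dftMatrix, of_apply, exp_eq_inv_zeta_pow]

theorem dftMatrix_mulVec (n : ℕ) (b : ℕ → ℂ) (k : Fin (2 * n)) :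
    (dftMatrix (2 * n) *ᵥ fun j => b j) k = ((√(2 * n : ℕ) : ℝ) : ℂ)⁻¹ * dft n (2 * n) b k := by
  rw [mulVec, dotProduct, dft, mul_sum, ← Fin.sum_univ_eq_sum_range (fun a : ℕ =>
    ((√(2 * n : ℕ) : ℝ) : ℂ)⁻¹ * (b a * (zeta n ^ (k * a : ℕ))⁻¹))]
  refine sum_congr rfl fun a _ => ?_
  rw [dftMatrix_apply]
  ring

theorem dftMatrix_mul_conjTranspose {n : ℕ} (hn : 0 < n) :
    dftMatrix (2 * n) * (dftMatrix (2 * n))ᴴ = 1 := by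
  have h_sq : ((√(2 * n : ℕ) : ℝ) : ℂ) * (√(2 * n : ℕ) : ℝ) = (2 * n : ℕ) := by
    rw [← Complex.ofReal_mul, Real.mul_self_sqrt (Nat.cast_nonneg _), Complex.ofReal_natCast]
  ext k l
  have h_orth := sum_zeta_pow_mul_inv hn l.2 k.2
  rw [← Fin.sum_univ_eq_sum_range (fun a : ℕ => zeta n ^ (l * a : ℕ) * (zeta n ^ (k * a : ℕ))⁻¹)]
    at h_orth
  calc (dftMatrix (2 * n) * (dftMatrix (2 * n))ᴴ) k l
      = ((2 * n : ℕ) : ℂ)⁻¹ * ∑ a : Fin (2 * n),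
          zeta n ^ (l * a : ℕ) * (zeta n ^ (k * a : ℕ))⁻¹ := by
        rw [mul_apply, mul_sum]
        refine sum_congr rfl fun a _ => ?_
        simp only [conjTranspose_apply, dftMatrix_apply, star_mul', star_inv₀, RCLike.star_def,
          conj_zeta_pow, _root_.inv_inv, Complex.conj_ofReal]
        rw [← h_sq, mul_inv]
        ring
    _ = (1 : Matrix _ _ ℂ) k l := by
        rw [h_orth, one_apply, mul_ite, mul_zero]
        refine if_congr ((Fin.val_inj).trans eq_comm) (inv_mul_cancel₀ ?_) rfl
        exact_mod_cast (by lia : 2 * n ≠ 0)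

theorem dftVec_circVec (n : ℕ) (k : Fin (2 * n)) : dftVec (circVec n) k = eig n k := by
  simp only [dftVec, circVec, exp_eq_inv_zeta_pow]
  generalize (k : ℕ) = k
  rw [Fin.sum_univ_eq_sum_range
    (fun a : ℕ => (if a < n then (1 : ℂ) else 0) * (zeta n ^ (k * a))⁻¹), two_mul, sum_range_add]
  simp only [add_lt_iff_neg_left, not_lt_zero, if_false, zero_mul, sum_const_zero, add_zero]
  exact sum_congr rfl fun a ha => by rw [if_pos (mem_range.1 ha)]

/-- The encoder in the frequency domain. -/
noncomputable def spectralEncoder (n : ℕ) : Matrix (Fin (2 * n)) (Fin n) ℂ :=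
  sqrtSigma n * dftMatrix (2 * n) * embedMatrix n

theorem encoder_eq (n : ℕ) : encoder n = (dftMatrix (2 * n))ᴴ * spectralEncoder n := rfl

theorem spectralEncoder_apply (n : ℕ) (k : Fin (2 * n)) (m : Fin n) :
    spectralEncoder n k m = Complex.sqrt (eig n k) *
      (((√(2 * n : ℕ) : ℝ) : ℂ)⁻¹ * (zeta n ^ (k * m : ℕ))⁻¹) := by
  have hm : (m : ℕ) < 2 * n := by lia
  rw [spectralEncoder, mul_apply, sum_eq_single_of_mem (⟨m, hm⟩ : Fin (2 * n)) (mem_univ _)]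
  · simp [sqrtSigma, diagonal_mul, dftMatrix_apply, dftVec_circVec, embedMatrix]
  · intro i _ hi
    have : (i : ℕ) ≠ m := fun h => hi (Fin.ext h)
    simp [embedMatrix, this]

theorem spectralEncoder_mulVec (n : ℕ) (x : ℕ → ℂ) (k : Fin (2 * n)) :
    (spectralEncoder n *ᵥ fun m => x m) k
      = ((√(2 * n : ℕ) : ℝ) : ℂ)⁻¹ * (Complex.sqrt (eig n k) * dft n n x k) := by
  rw [mulVec, dotProduct, dft, mul_sum, mul_sum, ← Fin.sum_univ_eq_sum_range (fun a : ℕ =>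
    ((√(2 * n : ℕ) : ℝ) : ℂ)⁻¹ * (Complex.sqrt (eig n k) * (x a * (zeta n ^ (k * a : ℕ))⁻¹)))]
  refine sum_congr rfl fun a _ => ?_
  rw [spectralEncoder_apply]
  ring

theorem conjTranspose_spectralEncoder_mulVec (n : ℕ) (r : ℕ → ℂ) (m : Fin n) :
    ((spectralEncoder n)ᴴ *ᵥ fun k => r k) m = ((√(2 * n : ℕ) : ℝ) : ℂ)⁻¹ *
      ∑ k ∈ range (2 * n), conj (Complex.sqrt (eig n k)) * r k * zeta n ^ (k * m : ℕ) := by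
  rw [mulVec, dotProduct, mul_sum, ← Fin.sum_univ_eq_sum_range (fun k : ℕ =>
    ((√(2 * n : ℕ) : ℝ) : ℂ)⁻¹ * (conj (Complex.sqrt (eig n k)) * r k * zeta n ^ (k * m : ℕ)))]
  refine sum_congr rfl fun k _ => ?_
  simp only [conjTranspose_apply, spectralEncoder_apply, star_mul', star_inv₀, RCLike.star_def,
    conj_zeta_pow, _root_.inv_inv, Complex.conj_ofReal]
  ring

theorem encoder_mulVec_eq_zero {n : ℕ} {v : Fin n → ℂ} (hv : encoder n *ᵥ v = 0) : v = 0 := by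
  funext m
  have hn := m.pos
  set x : ℕ → ℂ := fun m => if h : m < n then v ⟨m, h⟩ else 0 with hx
  have hvx : v = fun m : Fin n => x m := by simp [hx]
  have h_spec : spectralEncoder n *ᵥ v = 0 := by
    rw [← one_mulVec (_ *ᵥ v), ← dftMatrix_mul_conjTranspose hn, ← mulVec_mulVec,
      mulVec_mulVec v, ← encoder_eq, hv, mulVec_zero]
  have h_dft (j : ℕ) (hj : j < n) : dft n n x (2 * j + 1) = 0 := by
    have h := congrFun h_spec ⟨2 * j + 1, by lia⟩
    rw [hvx, spectralEncoder_mulVec, Pi.zero_apply] at h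
    have h_norm : ((√(2 * n : ℕ) : ℝ) : ℂ)⁻¹ ≠ 0 :=
      inv_ne_zero (Complex.ofReal_ne_zero.2 (by positivity))
    exact (mul_eq_zero.1 ((mul_eq_zero.1 h).resolve_left h_norm)).resolve_left
      (left_ne_zero_of_mul_eq_one (sqrt_eig_mul_invSqrtEig hn j))
  calc v m = oddInvDFT n (fun j => dft n n x (2 * j + 1)) m := by rw [oddInvDFT_dft x m.2, hvx]
    _ = 0 := by
      rw [oddInvDFT, sum_eq_zero fun j hj => by rw [h_dft j (mem_range.1 hj), zero_mul], zero_div]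

theorem pinv_encoder_mulVec {n : ℕ} (hn : 0 < n) (b : ℕ → ℂ) :
    pinv (encoder n) *ᵥ (fun j : Fin (2 * n) => b j) = fun m : Fin n => leastSquares n b m := by
  refine pinv_mulVec_eq (fun _ => encoder_mulVec_eq_zero) ?_
  set r : ℕ → ℂ := fun k => ((√(2 * n : ℕ) : ℝ) : ℂ)⁻¹ *
    (Complex.sqrt (eig n k) * dft n n (leastSquares n b) k - dft n (2 * n) b k) with hr
  have h_residual : (spectralEncoder n *ᵥ fun m : Fin n => leastSquares n b m)
      - dftMatrix (2 * n) *ᵥ (fun j : Fin (2 * n) => b j) = fun k : Fin (2 * n) => r k := by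
    funext k
    rw [Pi.sub_apply, spectralEncoder_mulVec, dftMatrix_mulVec, ← _root_.mul_sub]
  rw [encoder_eq, conjTranspose_mul, conjTranspose_conjTranspose, ← mulVec_mulVec,
    ← mulVec_mulVec, mulVec_mulVec _ (dftMatrix (2 * n)), dftMatrix_mul_conjTranspose hn,
    one_mulVec, ← mulVec_mulVec, ← sub_eq_zero, ← mulVec_sub, h_residual]
  funext m
  rw [conjTranspose_spectralEncoder_mulVec, Pi.zero_apply]
  simp only [hr, mul_left_comm _ (((√(2 * n : ℕ) : ℝ) : ℂ)⁻¹), mul_assoc, ← mul_sum]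
  simp only [← mul_assoc, leastSquares_normal b m.2, mul_zero]

theorem optDecoder_mulVec {n : ℕ} (b : ℕ → ℝ) (i : Fin n) :
    (optDecoder n *ᵥ fun j => (b j : ℂ)) i
      = ((∑ j ∈ range (i + 1), (leastSquares n (fun a => b a) j).re : ℝ) : ℂ) := by
  rw [optDecoder, ← mulVec_mulVec, pinv_encoder_mulVec i.pos fun a => (b a : ℂ)]
  have h_filter : {j ∈ range n | j ≤ (i : ℕ)} = range (i + 1) := by
    ext j
    simp only [mem_filter, mem_range]
    lia
  calc (prefixSum n *ᵥ fun m : Fin n => leastSquares n (fun a => b a) m) i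
      = ∑ j : Fin n, if (j : ℕ) ≤ i then leastSquares n (fun a => b a) j else 0 := by
        simp [prefixSum, mulVec, dotProduct]
    _ = ∑ j ∈ range (i + 1), leastSquares n (fun a => b a) j := by
        rw [Fin.sum_univ_eq_sum_range (fun j : ℕ =>
          if j ≤ (i : ℕ) then leastSquares n (fun a => b a) j else 0), ← sum_filter, h_filter]
    _ = _ := by
        rw [Complex.ofReal_sum]
        refine sum_congr rfl fun j hj => (Complex.conj_eq_iff_re.1 (conj_leastSquares b ?_)).symm
        have := mem_range.1 hj
        lia

/-! ### Bluestein's chirp transform -/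

/-- The first entries of the convolution of `A 0, …, A (n - 1)` with the even extension of `F`;
`(i - j) + (j - i)` is the distance of `i` and `j` in truncated subtraction. -/
def evenConv (n : ℕ) (A F : ℕ → ℂ) (i : ℕ) : ℂ :=
  ∑ j ∈ range n, A j * F ((i - j) + (j - i))

theorem zeta_pow_dist_sq_mul (n i j : ℕ) :
    zeta n ^ ((i - j) + (j - i)) ^ 2 * zeta n ^ (2 * i * j) = zeta n ^ i ^ 2 * zeta n ^ j ^ 2 := by
  rw [← pow_add, ← pow_add]
  congr 1
  rcases le_total i j with h | h <;> obtain ⟨d, rfl⟩ := Nat.exists_eq_add_of_le h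
  all_goals
    rw [Nat.sub_eq_zero_of_le (Nat.le_add_right _ _), Nat.add_sub_cancel_left]
    ring

theorem dft_odd_eq_evenConv (n : ℕ) (d : ℕ → ℂ) (i : ℕ) :
    zeta n ^ i ^ 2 * dft n n d (2 * i + 1)
      = evenConv n (fun j => d j * conj (zeta n ^ (j ^ 2 + j))) (fun e => zeta n ^ e ^ 2) i := by
  rw [dft, evenConv, mul_sum]
  refine sum_congr rfl fun j _ => ?_
  have h := zeta_pow_dist_sq_mul n i j
  have h_sq := pow_ne_zero (j ^ 2) (zeta_ne_zero n)
  have h_pow := pow_ne_zero j (zeta_ne_zero n)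
  have h_cross := pow_ne_zero (2 * i * j) (zeta_ne_zero n)
  rw [conj_zeta_pow, add_mul, one_mul, pow_add, pow_add, mul_inv, mul_inv]
  generalize zeta n ^ ((i - j) + (j - i)) ^ 2 = c, zeta n ^ j ^ 2 = z, zeta n ^ j = u,
    zeta n ^ (2 * i * j) = w at *
  field_simp
  linear_combination -d j * h

theorem oddInvDFT_eq_evenConv (n : ℕ) (y : ℕ → ℂ) (m : ℕ) :
    oddInvDFT n y m = zeta n ^ (m ^ 2 + m) *
      evenConv n (fun j => y j * zeta n ^ j ^ 2) (fun e => conj (zeta n ^ e ^ 2)) m / n := by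
  rw [oddInvDFT, evenConv, mul_sum]
  refine congrArg (· / (n : ℂ)) (sum_congr rfl fun j _ => ?_)
  have h := zeta_pow_dist_sq_mul n m j
  have hne := pow_ne_zero (((m - j) + (j - m)) ^ 2) (zeta_ne_zero n)
  rw [conj_zeta_pow, add_mul, one_mul, pow_add, pow_add, mul_right_comm 2 j]
  generalize zeta n ^ ((m - j) + (j - m)) ^ 2 = c at *
  field_simp
  linear_combination y j * zeta n ^ m * h

theorem negacyclicSol_eq_evenConv (n : ℕ) (d : ℕ → ℂ) (m : ℕ) :
    negacyclicSol n d m = zeta n ^ (m ^ 2 + m) * evenConv n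
      (fun j => invSqrtEig n j *
        evenConv n (fun a => d a * conj (zeta n ^ (a ^ 2 + a))) (fun e => zeta n ^ e ^ 2) j)
      (fun e => conj (zeta n ^ e ^ 2)) m / n := by
  simp only [negacyclicSol, oddInvDFT_eq_evenConv, ← dft_odd_eq_evenConv, mul_assoc, mul_comm]

end FFTMech

namespace FFTMech

open Finset Polynomial

/-! ### Polynomial multiplication in memory -/

/-- Combines the first `k` cells of the block of length `H` at `O` with the corresponding cells of
the next block: `f` gives the new value of the lower cell of a pair and `g` that of the upper. -/
def pairMap {α : Type*} (f g : α → α → α) (O H k : ℕ) (M : ℕ → α) (x : ℕ) : α :=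
  if O ≤ x ∧ x < O + k then f (M x) (M (x + H))
  else if O + H ≤ x ∧ x < O + H + k then g (M (x - H)) (M x)
  else M x

section pairMap

variable {α : Type*} {f g : α → α → α} {O H k : ℕ} {M : ℕ → α}

theorem pairMap_low {j : ℕ} (hj : j < k) :
    pairMap f g O H k M (O + j) = f (M (O + j)) (M (O + H + j)) := by
  rw [pairMap, if_pos (by lia), add_right_comm]

theorem pairMap_high {j : ℕ} (hk : k ≤ H) (hj : j < k) :
    pairMap f g O H k M (O + H + j) = g (M (O + j)) (M (O + H + j)) := by
  rw [pairMap, if_neg (by lia), if_pos (by lia), show O + H + j - H = O + j by lia]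

theorem pairMap_of_notMem {x : ℕ} (h_low : x < O ∨ O + k ≤ x) (h_high : x < O + H ∨ O + H + k ≤ x) :
    pairMap f g O H k M x = M x := by
  rw [pairMap, if_neg (by lia), if_neg (by lia)]

theorem pairMap_zero : pairMap f g O H 0 M = M :=
  funext fun _ => pairMap_of_notMem (by lia) (by lia)

theorem pairMap_succ (hk : k < H) :
    pairMap f g O H (k + 1) M = Function.update
      (Function.update (pairMap f g O H k M) (O + k) (f (M (O + k)) (M (O + H + k))))
      (O + H + k) (g (M (O + k)) (M (O + H + k))) := by
  funext x
  rcases eq_or_ne x (O + H + k) with rfl | h_high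
  · rw [Function.update_self, pairMap_high hk (Nat.lt_succ_self k)]
  rcases eq_or_ne x (O + k) with rfl | h_low
  · rw [Function.update_of_ne h_high, Function.update_self, pairMap_low (Nat.lt_succ_self k)]
  · rw [Function.update_of_ne h_high, Function.update_of_ne h_low, pairMap, pairMap]
    split_ifs <;> first | rfl | lia

end pairMap

/-- Reduction of a polynomial modulo `X ^ m - w` and modulo `X ^ m + w`, with the coefficients of
each of two polynomials in every other cell, so that `H = 2m`. -/
def butterfly {K : Type*} [Ring K] (w : K) (O H k : ℕ) (M : ℕ → K) : ℕ → K :=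
  pairMap (fun a b => a + w * b) (fun a b => a - w * b) O H k M

/-- The inverse of `butterfly`. -/
def unbutterfly {K : Type*} [DivisionRing K] (w : K) (O H k : ℕ) (M : ℕ → K) : ℕ → K :=
  pairMap (fun a b => (a + b) / 2) (fun a b => (a - b) / (w + w)) O H k M

/-- The memory after the polynomials whose coefficients are in the even and in the odd cells of the
block of length `2 ^ (k + 1)` at `O` have been multiplied modulo `X ^ 2 ^ k - c`. The product is
left in the even cells. -/
noncomputable def polyMul : ℕ → ℂ → ℕ → (ℕ → ℂ) → ℕ → ℂ
  | 0, _, O, M => Function.update M O (M O * M (O + 1))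
  | k + 1, c, O, M =>
      let w := csqrt c
      let H := 2 ^ (k + 1)
      unbutterfly w O H H (polyMul k (-w) (O + H) (polyMul k w O (butterfly w O H H M)))

theorem polyMul_of_notMem (k : ℕ) (c : ℂ) (O : ℕ) (M : ℕ → ℂ) {x : ℕ}
    (hx : x < O ∨ O + 2 ^ (k + 1) ≤ x) : polyMul k c O M x = M x := by
  induction k generalizing c O M with
  | zero => exact Function.update_of_ne (by lia) _ _
  | succ k ih =>
    have h_two : 2 ^ (k + 1 + 1) = 2 ^ (k + 1) + 2 ^ (k + 1) := by ring
    rw [polyMul, unbutterfly, pairMap_of_notMem (by lia) (by lia), ih _ _ _ (by lia),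
      ih _ _ _ (by lia), butterfly, pairMap_of_notMem (by lia) (by lia)]

/-- The polynomial with `m` coefficients in the cells `O, O + 2, O + 4, …`. -/
noncomputable def cellPoly {R : Type*} [Semiring R] (m O : ℕ) (M : ℕ → R) : R[X] :=
  ∑ j ∈ range m, C (M (O + 2 * j)) * X ^ j

section cellPoly

variable {R : Type*} [CommSemiring R]

theorem coeff_cellPoly (m O : ℕ) (M : ℕ → R) (i : ℕ) :
    (cellPoly m O M).coeff i = if i < m then M (O + 2 * i) else 0 := by
  simp [cellPoly, finsetSum_coeff, coeff_C_mul, coeff_X_pow]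

theorem natDegree_cellPoly_lt {m : ℕ} (hm : 0 < m) (O : ℕ) (M : ℕ → R) :
    (cellPoly m O M).natDegree < m := by
  refine Nat.lt_of_le_pred hm (natDegree_le_iff_coeff_eq_zero.2 fun i hi => ?_)
  rw [coeff_cellPoly, if_neg (not_lt.2 (Nat.le_of_pred_lt hi))]

theorem cellPoly_congr {m O : ℕ} {M M' : ℕ → R} (h : ∀ j < m, M (O + 2 * j) = M' (O + 2 * j)) :
    cellPoly m O M = cellPoly m O M' :=
  sum_congr rfl fun j hj => by rw [h j (mem_range.1 hj)]

theorem cellPoly_eq_of_le {m m' O : ℕ} {M : ℕ → R} (hm : m ≤ m')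
    (h0 : ∀ j, m ≤ j → M (O + 2 * j) = 0) : cellPoly m' O M = cellPoly m O M := by
  ext i
  rw [coeff_cellPoly, coeff_cellPoly]
  split_ifs <;> first | rfl | exact h0 i (by lia) | lia

theorem cellPoly_two_mul (m O : ℕ) (M : ℕ → R) :
    cellPoly (2 * m) O M = cellPoly m O M + X ^ m * cellPoly m (O + 2 * m) M := by
  rw [cellPoly, two_mul m, sum_range_add, cellPoly, cellPoly, mul_sum]
  congr 1
  refine sum_congr rfl fun j _ => ?_
  rw [_root_.mul_add, ← add_assoc, pow_add, mul_left_comm, two_mul m]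

theorem cellPoly_linear {m O P Q : ℕ} {M M' : ℕ → R} {a b : R}
    (h : ∀ j < m, M (O + 2 * j) = a * M' (P + 2 * j) + b * M' (Q + 2 * j)) :
    cellPoly m O M = C a * cellPoly m P M' + C b * cellPoly m Q M' := by
  simp only [cellPoly, mul_sum, ← sum_add_distrib]
  refine sum_congr rfl fun j hj => ?_
  rw [h j (mem_range.1 hj)]
  simp only [C_add, C_mul]
  ring

end cellPoly

theorem cellPoly_butterfly_low {R : Type*} [CommRing R] {e : ℕ} (he : e ≤ 1) (w : R) (m O : ℕ)
    (M : ℕ → R) : cellPoly m (O + e) (butterfly w O (2 * m) (2 * m) M)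
      = cellPoly m (O + e) M + C w * cellPoly m (O + 2 * m + e) M := by
  rw [← one_mul (cellPoly m (O + e) M), ← C_1]
  refine cellPoly_linear fun j hj => ?_
  rw [add_assoc, butterfly, pairMap_low (by lia)]
  ring_nf

theorem cellPoly_butterfly_high {R : Type*} [CommRing R] {e : ℕ} (he : e ≤ 1) (w : R) (m O : ℕ)
    (M : ℕ → R) : cellPoly m (O + 2 * m + e) (butterfly w O (2 * m) (2 * m) M)
      = cellPoly m (O + e) M - C w * cellPoly m (O + 2 * m + e) M := by
  rw [← one_mul (cellPoly m (O + e) M), ← C_1, sub_eq_add_neg, ← neg_mul, ← C_neg]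
  refine cellPoly_linear fun j hj => ?_
  rw [add_assoc, butterfly, pairMap_high le_rfl (by lia)]
  ring_nf

theorem cellPoly_unbutterfly {K : Type*} [Field K] (w : K) (m O : ℕ) (M : ℕ → K) :
    cellPoly (2 * m) O (unbutterfly w O (2 * m) (2 * m) M)
      = C (1 / 2) * (cellPoly m O M + cellPoly m (O + 2 * m) M)
        + X ^ m * (C (1 / (w + w)) * (cellPoly m O M - cellPoly m (O + 2 * m) M)) := by
  rw [cellPoly_two_mul, _root_.mul_add (C _), _root_.mul_sub (C (1 / (w + w))), sub_eq_add_neg,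
    ← neg_mul, ← C_neg]
  congr 2
  · refine cellPoly_linear fun j hj => ?_
    rw [unbutterfly, pairMap_low (by lia)]
    ring
  · refine cellPoly_linear fun j hj => ?_
    rw [unbutterfly, pairMap_high le_rfl (by lia)]
    ring

theorem sub_dvd_of_halves {R : Type*} [CommRing R] {x w a h A₀ A₁ B₀ B₁ P Q : R}
    (hh : h + h = 1) (ha : w * a = h) (hP : x - w ∣ (A₀ + w * A₁) * (B₀ + w * B₁) - P) :
    x - w ∣ (A₀ + x * A₁) * (B₀ + x * B₁) - (h * (P + Q) + x * (a * (P - Q))) := by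
  obtain ⟨q, hq⟩ := hP
  refine ⟨q + (A₀ * B₁ + A₁ * B₀ + (x + w) * A₁ * B₁ - a * (P - Q)), ?_⟩
  linear_combination hq - (P - Q) * ha - P * hh

/-- The Chinese remainder theorem for the moduli `x - w` and `x + w`. -/
theorem sub_mul_add_dvd_of_halves {R : Type*} [CommRing R] {x w a h A₀ A₁ B₀ B₁ P Q : R}
    (hh : h + h = 1) (ha : w * a = h) (hP : x - w ∣ (A₀ + w * A₁) * (B₀ + w * B₁) - P)
    (hQ : x + w ∣ (A₀ - w * A₁) * (B₀ - w * B₁) - Q) :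
    (x - w) * (x + w) ∣ (A₀ + x * A₁) * (B₀ + x * B₁) - (h * (P + Q) + x * (a * (P - Q))) := by
  have h_coprime : IsCoprime (x - w) (x + w) := ⟨-a, a, by linear_combination 2 * ha + hh⟩
  refine h_coprime.mul_dvd (sub_dvd_of_halves hh ha hP) ?_
  have h_neg := sub_dvd_of_halves (x := x) (w := -w) (a := -a) (A₀ := A₀) (A₁ := A₁) (B₀ := B₀)
    (B₁ := B₁) (P := Q) (Q := P) hh (by rw [neg_mul_neg, ha]) (by simpa [sub_eq_add_neg] using hQ)
  rw [sub_neg_eq_add] at h_neg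
  convert h_neg using 2
  ring

theorem dvd_cellPoly_unbutterfly {K : Type*} [Field K] [NeZero (2 : K)] {w : K} (hw : w ≠ 0)
    {m O : ℕ} {M M' : ℕ → K}
    (h_low : X ^ m - C w ∣ cellPoly m O (butterfly w O (2 * m) (2 * m) M)
      * cellPoly m (O + 1) (butterfly w O (2 * m) (2 * m) M) - cellPoly m O M')
    (h_high : X ^ m + C w ∣ cellPoly m (O + 2 * m) (butterfly w O (2 * m) (2 * m) M)
      * cellPoly m (O + 2 * m + 1) (butterfly w O (2 * m) (2 * m) M)
        - cellPoly m (O + 2 * m) M') :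
    X ^ (2 * m) - C (w * w) ∣ cellPoly (2 * m) O M * cellPoly (2 * m) (O + 1) M
      - cellPoly (2 * m) O (unbutterfly w O (2 * m) (2 * m) M') := by
  have h_half : (C (1 / 2) : K[X]) + C (1 / 2) = 1 := by rw [← C_add, add_halves, C_1]
  have h_inv : (C w : K[X]) * C (1 / (w + w)) = C (1 / 2) := by
    rw [← C_mul, ← two_mul, mul_one_div, div_mul_cancel_right₀ hw, one_div]
  have low (e : ℕ) (he : e ≤ 1) := cellPoly_butterfly_low he w m O M
  have high (e : ℕ) (he : e ≤ 1) := cellPoly_butterfly_high he w m O M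
  have low_zero := low 0 zero_le_one
  have high_zero := high 0 zero_le_one
  simp only [add_zero] at low_zero high_zero
  rw [low_zero, low 1 le_rfl] at h_low
  rw [high_zero, high 1 le_rfl] at h_high
  rw [cellPoly_two_mul, cellPoly_two_mul, cellPoly_unbutterfly, add_right_comm O 1]
  convert sub_mul_add_dvd_of_halves h_half h_inv h_low h_high using 1
  rw [C_mul]
  ring

theorem polyMul_dvd (k : ℕ) {c : ℂ} (hc : c.im ≠ 0) (O : ℕ) (M : ℕ → ℂ) :
    X ^ 2 ^ k - C c ∣ cellPoly (2 ^ k) O M * cellPoly (2 ^ k) (O + 1) M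
      - cellPoly (2 ^ k) O (polyMul k c O M) := by
  induction k generalizing c O M with
  | zero => simp [cellPoly, polyMul]
  | succ k ih =>
    obtain ⟨w, hw⟩ : ∃ w, csqrt c = w := ⟨_, rfl⟩
    have h_sq : w * w = c := hw ▸ csqrt_mul_self (.inr hc)
    have h_im : w.im ≠ 0 := hw ▸ csqrt_im_ne_zero hc
    have hw0 : w ≠ 0 := fun h => h_im (by rw [h, Complex.zero_im])
    obtain ⟨m, hm⟩ : ∃ m, 2 ^ k = m := ⟨_, rfl⟩
    have h_pow : 2 ^ (k + 1) = 2 * m := by rw [pow_succ', hm]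
    simp only [polyMul, hw, h_pow]
    rw [← h_sq]
    set M₁ := butterfly w O (2 * m) (2 * m) M
    have h_low := ih h_im O M₁
    have h_high := ih (c := -w) (by simpa using h_im) (O + 2 * m) (polyMul k w O M₁)
    have h_keep_low : cellPoly m O (polyMul k (-w) (O + 2 * m) (polyMul k w O M₁))
        = cellPoly m O (polyMul k w O M₁) :=
      cellPoly_congr fun j hj => polyMul_of_notMem _ _ _ _ (by lia)
    have h_keep_high (e : ℕ) : cellPoly m (O + 2 * m + e) (polyMul k w O M₁)
        = cellPoly m (O + 2 * m + e) M₁ :=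
      cellPoly_congr fun _ _ => polyMul_of_notMem _ _ _ _ (by lia)
    have h_keep_high_zero := h_keep_high 0
    rw [add_zero] at h_keep_high_zero
    rw [hm, ← h_keep_low] at h_low
    rw [hm, C_neg, sub_neg_eq_add, h_keep_high_zero, h_keep_high 1] at h_high
    exact dvd_cellPoly_unbutterfly hw0 h_low h_high

theorem cellPoly_polyMul {k a b : ℕ} (hk : a + b ≤ 2 ^ k + 1) (ha : 0 < a) (hb : 0 < b) {c : ℂ}
    (hc : c.im ≠ 0) {O : ℕ} {M : ℕ → ℂ} (hA : ∀ j, a ≤ j → M (O + 2 * j) = 0)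
    (hB : ∀ j, b ≤ j → M (O + 2 * j + 1) = 0) :
    cellPoly (2 ^ k) O (polyMul k c O M) = cellPoly a O M * cellPoly b (O + 1) M := by
  have h_dvd := polyMul_dvd k hc O M
  have degA := natDegree_cellPoly_lt ha O M
  have degB := natDegree_cellPoly_lt hb (O + 1) M
  have degR := natDegree_cellPoly_lt (Nat.two_pow_pos k) O (polyMul k c O M)
  rw [cellPoly_eq_of_le (m := a) (by lia) hA, cellPoly_eq_of_le (m := b) (O := O + 1) (by lia)
    fun j hj => by rw [add_right_comm, hB j hj]] at h_dvd
  refine (sub_eq_zero.1 (eq_zero_of_dvd_of_natDegree_lt h_dvd ?_)).symm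
  rw [natDegree_X_pow_sub_C]
  exact (natDegree_sub_le _ _).trans_lt
    (max_lt (natDegree_mul_le.trans_lt (by lia)) degR)

/-- The first `k` steps of writing `A 0, …, A (n - 1)` and the sequence with value `F |j - n|` at
`j < 2n` to the even and to the odd cells from `O` on. -/
def load {α : Type*} (n O : ℕ) (A F : ℕ → α) : ℕ → (ℕ → α) → ℕ → α
  | 0, M => M
  | k + 1, M => Function.update (Function.update (Function.update (load n O A F k M)
      (O + 2 * k) (A k)) (O + 2 * (n + k) + 1) (F k)) (O + 2 * (n - k) + 1) (F k)

section load

variable {α : Type*} {n O : ℕ} {A F : ℕ → α} {k : ℕ} {M : ℕ → α}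

theorem load_of_notMem (hk : k ≤ n) {x : ℕ} (hx : x < O ∨ O + 4 * n ≤ x) :
    load n O A F k M x = M x := by
  induction k with
  | zero => rfl
  | succ k ih =>
    rw [load, Function.update_of_ne (by lia), Function.update_of_ne (by lia),
      Function.update_of_ne (by lia), ih (by lia)]

theorem load_even (j : ℕ) :
    load n O A F k M (O + 2 * j) = if j < k then A j else M (O + 2 * j) := by
  induction k with
  | zero => rfl
  | succ k ih =>
    rw [load, Function.update_of_ne (by lia), Function.update_of_ne (by lia)]
    rcases eq_or_ne j k with rfl | hj
    · rw [Function.update_self, if_pos (Nat.lt_succ_self j)]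
    · rw [Function.update_of_ne (by lia), ih]
      split_ifs <;> first | rfl | lia

theorem load_odd (hk : k ≤ n) (j : ℕ) :
    load n O A F k M (O + 2 * j + 1)
      = if n < j + k ∧ j < n + k then F (j - n + (n - j)) else M (O + 2 * j + 1) := by
  induction k with
  | zero => rw [load, if_neg (by lia)]
  | succ k ih =>
    rw [load]
    rcases eq_or_ne j (n - k) with rfl | h_low
    · rw [Function.update_self, if_pos (by lia), show n - k - n + (n - (n - k)) = k by lia]
    rw [Function.update_of_ne (by lia)]
    rcases eq_or_ne j (n + k) with rfl | h_high
    · rw [Function.update_self, if_pos (by lia), show n + k - n + (n - (n + k)) = k by lia]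
    rw [Function.update_of_ne (by lia), Function.update_of_ne (by lia), ih (by lia)]
    split_ifs <;> first | rfl | lia

end load

theorem polyMul_load {k n : ℕ} (hk : 3 * n ≤ 2 ^ k) {c : ℂ} (hc : c.im ≠ 0) {O : ℕ}
    (A F : ℕ → ℂ) {M : ℕ → ℂ} (hM : ∀ x, O ≤ x → M x = 0) {i : ℕ} (hi : i < n) :
    polyMul k c O (load n O A F n M) (O + 2 * (n + i)) = evenConv n A F i := by
  have h_prod := cellPoly_polyMul (k := k) (a := n) (b := 2 * n) (O := O)
    (M := load n O A F n M) (by lia) (by lia) (by lia) hc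
    (fun j hj => by rw [load_even, if_neg (by lia), hM _ (by lia)])
    fun j hj => by rw [load_odd le_rfl, if_neg (by lia), hM _ (by lia)]
  have h_coeff := congrArg (fun p : ℂ[X] => p.coeff (n + i)) h_prod
  rw [coeff_cellPoly, if_pos (by lia), coeff_mul, Nat.sum_antidiagonal_eq_sum_range_succ
    fun a b => (cellPoly n O _).coeff a * (cellPoly (2 * n) (O + 1) _).coeff b] at h_coeff
  rw [h_coeff, evenConv]
  symm
  refine sum_subset_zero_on_sdiff (range_subset_range.2 (by lia)) (fun j hj => ?_)
    fun j hj => ?_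
  · rw [coeff_cellPoly, if_neg (by simp_all), zero_mul]
  · have hjn := mem_range.1 hj
    rw [coeff_cellPoly, coeff_cellPoly, if_pos hjn, if_pos (by lia), add_right_comm, load_even,
      if_pos hjn, load_odd le_rfl, if_pos (by lia),
      show n + i - j - n + (n - (n + i - j)) = i - j + (j - i) by lia]

end FFTMech

namespace RealRAM

open FFTMech

/-! ### Complex arithmetic on the machine -/

/-- The complex number held by real registers `2x + 2` and `2x + 3`; the real registers `0` and `1`
are scratch. -/
def State.creg (s : State) (x : ℕ) : ℂ := ⟨s.rreg (2 * x + 2), s.rreg (2 * x + 3)⟩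

/-- Complex memory cells: the `i`-th one is made of the real cells `2i` and `2i + 1`. -/
def cells (m : ℕ → ℝ) (i : ℕ) : ℂ := ⟨m (2 * i), m (2 * i + 1)⟩

theorem eq_of_cells_eq {m m' : ℕ → ℝ} {j : ℕ} (h : cells m (j / 2) = cells m' (j / 2)) :
    m j = m' j := by
  simp only [cells, Complex.mk.injEq] at h
  rcases Nat.even_or_odd' j with ⟨i, rfl | rfl⟩
  · simpa using h.1
  · simpa [show (2 * i + 1) / 2 = i by lia] using h.2

/-- The complex memory of a state. -/
def State.cmem (s : State) : ℕ → ℂ := cells s.rmem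

/-- Writing `v` to natural-number register `x`. -/
def State.setN (s : State) (x v : ℕ) : State :=
  { s with nreg := Function.update s.nreg x v }

/-- Writing the parts of `v` to the scratch registers. -/
def State.scratch (s : State) (v : ℂ) : State :=
  { s with rreg := Function.update (Function.update s.rreg 0 v.re) 1 v.im }

/-- Writing `v` to complex register `x`, through the scratch registers. -/
def State.setC (s : State) (x : ℕ) (v : ℂ) : State :=
  { s.scratch v with
    rreg := Function.update (Function.update (s.scratch v).rreg (2 * x + 2) v.re)
      (2 * x + 3) v.im }

/-- Writing `v` to complex memory cell `a`, through the scratch registers. -/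
def State.storeC (s : State) (a : ℕ) (v : ℂ) : State :=
  { s.scratch v with
    rmem := Function.update (Function.update s.rmem (2 * a) v.re) (2 * a + 1) v.im }

/-- Writing `v` to real memory cell `a`. -/
def State.storeR (s : State) (a : ℕ) (v : ℝ) : State :=
  { s with rmem := Function.update s.rmem a v }

section State

variable (s : State) (x a v : ℕ) (z : ℂ) (r : ℝ)

@[simp] theorem State.nreg_setN : (s.setN x v).nreg = Function.update s.nreg x v := rfl
@[simp] theorem State.rmem_setN : (s.setN x v).rmem = s.rmem := rfl
@[simp] theorem State.creg_setN : (s.setN x v).creg = s.creg := rfl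
@[simp] theorem State.cmem_setN : (s.setN x v).cmem = s.cmem := rfl
@[simp] theorem State.nreg_setC : (s.setC x z).nreg = s.nreg := rfl
@[simp] theorem State.rmem_setC : (s.setC x z).rmem = s.rmem := rfl
@[simp] theorem State.cmem_setC : (s.setC x z).cmem = s.cmem := rfl
@[simp] theorem State.nreg_storeC : (s.storeC a z).nreg = s.nreg := rfl
@[simp] theorem State.nreg_storeR : (s.storeR a r).nreg = s.nreg := rfl
@[simp] theorem State.creg_storeR : (s.storeR a r).creg = s.creg := rfl
@[simp] theorem State.rmem_storeR : (s.storeR a r).rmem = Function.update s.rmem a r := rfl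

@[simp] theorem State.creg_scratch : (s.scratch z).creg = s.creg := by
  ext y
  simp [creg, scratch]

@[simp] theorem State.creg_setC : (s.setC x z).creg = Function.update s.creg x z := by
  ext y
  rcases eq_or_ne y x with rfl | h
  · simp [creg, setC]
  · rw [Function.update_of_ne h]
    simp [creg, setC, scratch, h, show 2 * y ≠ 2 * x + 1 by lia,
      show 2 * y + 3 ≠ 2 * x + 2 by lia]

@[simp] theorem State.creg_storeC : (s.storeC a z).creg = s.creg :=
  s.creg_scratch z

@[simp] theorem State.cmem_storeC : (s.storeC a z).cmem = Function.update s.cmem a z := by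
  ext i
  rcases eq_or_ne i a with rfl | h
  · simp [cmem, cells, storeC]
  · rw [Function.update_of_ne h]
    simp [cmem, cells, storeC, h, show 2 * i ≠ 2 * a + 1 by lia,
      show 2 * i + 1 ≠ 2 * a by lia]

end State

/-- Complex-valued expressions; `load` reads a complex memory cell, `cell` a real one. -/
inductive CExp where
  | const (c : ℤ)
  | I
  | reg (x : ℕ)
  | load (e : NExp)
  | cell (e : NExp)
  | root (e : NExp)
  | conj (e : CExp)
  | im (e : CExp)
  | add (e f : CExp)
  | sub (e f : CExp)
  | mul (e f : CExp)
  | div (e f : CExp)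
  | csqrt (e : CExp)

/-- Real expressions for the real and the imaginary part. -/
def CExp.parts : CExp → RExp × RExp
  | .const c => (.const c, .const 0)
  | .I => (.const 0, .const 1)
  | .reg x => (.reg (2 * x + 2), .reg (2 * x + 3))
  | .load e => (.load (.add e e), .load (.add (.add e e) (.const 1)))
  | .cell e => (.load e, .const 0)
  | .root e => (.cosPi e, .sinPi e)
  | .conj e => (e.parts.1, .sub (.const 0) e.parts.2)
  | .im e => (e.parts.2, .const 0)
  | .add e f => (.add e.parts.1 f.parts.1, .add e.parts.2 f.parts.2)
  | .sub e f => (.sub e.parts.1 f.parts.1, .sub e.parts.2 f.parts.2)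
  | .mul e f => (.sub (.mul e.parts.1 f.parts.1) (.mul e.parts.2 f.parts.2),
      .add (.mul e.parts.1 f.parts.2) (.mul e.parts.2 f.parts.1))
  | .div e f =>
      let d := RExp.add (.mul f.parts.1 f.parts.1) (.mul f.parts.2 f.parts.2)
      (.add (.div (.mul e.parts.1 f.parts.1) d) (.div (.mul e.parts.2 f.parts.2) d),
        .sub (.div (.mul e.parts.2 f.parts.1) d) (.div (.mul e.parts.1 f.parts.2) d))
  | .csqrt e =>
      let r := RExp.sqrt (.div (.add (.sqrt (.add (.mul e.parts.1 e.parts.1)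
        (.mul e.parts.2 e.parts.2))) e.parts.1) (.const 2))
      (r, .div e.parts.2 (.mul (.const 2) r))

/-- The value of a complex expression. -/
noncomputable def CExp.eval (s : State) : CExp → ℂ
  | .const c => c
  | .I => Complex.I
  | .reg x => s.creg x
  | .load e => s.cmem (e.eval s)
  | .cell e => (s.rmem (e.eval s) : ℂ)
  | .root e => zeta (e.eval s)
  | .conj e => starRingEnd ℂ (e.eval s)
  | .im e => ((e.eval s).im : ℂ)
  | .add e f => e.eval s + f.eval s
  | .sub e f => e.eval s - f.eval s
  | .mul e f => e.eval s * f.eval s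
  | .div e f => e.eval s / f.eval s
  | .csqrt e => FFTMech.csqrt (e.eval s)

theorem CExp.eval_parts (s : State) (e : CExp) :
    e.parts.1.eval s = (e.eval s).re ∧ e.parts.2.eval s = (e.eval s).im := by
  induction e with
  | const c => simp [parts, eval, RExp.eval]
  | I => simp [parts, eval, RExp.eval]
  | reg x => simp [parts, eval, RExp.eval, State.creg]
  | load e => simp [parts, eval, RExp.eval, State.cmem, cells, NExp.eval, two_mul]
  | cell e => simp [parts, eval, RExp.eval]
  | root e =>
    have h_angle : (Real.pi / (e.eval s : ℂ) * Complex.I)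
        = ((Real.pi / (e.eval s : ℝ) : ℝ) : ℂ) * Complex.I := by push_cast; rfl
    simp only [parts, eval, RExp.eval, zeta, h_angle, Complex.exp_ofReal_mul_I_re,
      Complex.exp_ofReal_mul_I_im, and_self]
  | conj e ih => simp [parts, eval, RExp.eval, ih]
  | im e ih => simp [parts, eval, RExp.eval, ih]
  | add e f ihe ihf => simp [parts, eval, RExp.eval, ihe, ihf]
  | sub e f ihe ihf => simp [parts, eval, RExp.eval, ihe, ihf]
  | mul e f ihe ihf => simp [parts, eval, RExp.eval, ihe, ihf]
  | div e f ihe ihf =>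
    simp [parts, eval, RExp.eval, ihe, ihf, Complex.div_re, Complex.div_im, Complex.normSq_apply]
  | csqrt e ih =>
    simp [parts, eval, RExp.eval, ih, FFTMech.csqrt, Complex.norm_def, Complex.normSq_apply]

theorem NExp.eval_congr {s s' : State} (hn : s.nreg = s'.nreg) (hm : s.nmem = s'.nmem)
    (e : NExp) : e.eval s = e.eval s' := by
  induction e <;> simp_all [NExp.eval]

theorem CExp.eval_congr {s s' : State} (hn : s.nreg = s'.nreg) (hm : s.nmem = s'.nmem)
    (hr : s.rmem = s'.rmem) (hc : s.creg = s'.creg) (e : CExp) : e.eval s = e.eval s' := by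
  induction e <;> simp_all [CExp.eval, NExp.eval_congr hn hm, State.cmem]

/-- Straight-line instructions. -/
inductive Op where
  | setN (x : ℕ) (e : NExp)
  | setC (x : ℕ) (e : CExp)
  | storeC (a : NExp) (e : CExp)
  | storeR (a : NExp) (e : CExp)

/-- The command evaluating a complex expression into the scratch registers. -/
def CExp.toScratch (e : CExp) : Cmd := .seq (.setR 0 e.parts.1) (.setR 1 e.parts.2)

/-- The command carrying out an instruction. Both parts of a complex value are evaluated before
either of them is written, since the expression may read the place that is written. -/
def Op.toCmd : Op → Cmd
  | .setN x e => .setN x e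
  | .setC x e => .seq e.toScratch (.seq (.setR (2 * x + 2) (.reg 0)) (.setR (2 * x + 3) (.reg 1)))
  | .storeC a e => .seq e.toScratch
      (.seq (.storeR (.add a a) (.reg 0)) (.storeR (.add (.add a a) (.const 1)) (.reg 1)))
  | .storeR a e => .storeR a e.parts.1

/-- The number of steps taken by an instruction. -/
def Op.cost : Op → ℕ
  | .setN _ e => e.cost + 1
  | .setC _ e => e.parts.1.cost + e.parts.2.cost + 6
  | .storeC a e => e.parts.1.cost + e.parts.2.cost + 4 * a.cost + 10
  | .storeR a e => a.cost + e.parts.1.cost + 1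

/-- The effect of an instruction. -/
noncomputable def Op.run (s : State) : Op → State
  | .setN x e => s.setN x (e.eval s)
  | .setC x e => s.setC x (e.eval s)
  | .storeC a e => s.storeC (a.eval s) (e.eval s)
  | .storeR a e => s.storeR (a.eval s) (e.eval s).re

section Exec

variable {procs : List Cmd}

theorem Exec.congr {c : Cmd} {s s₁ s₂ : State} {t₁ t₂ : ℕ} (h : Exec procs c s t₁ s₁)
    (ht : t₁ = t₂) (hs : s₁ = s₂) : Exec procs c s t₂ s₂ :=
  ht ▸ hs ▸ h

theorem CExp.exec_toScratch (s : State) (e : CExp) :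
    Exec procs e.toScratch s (e.parts.1.cost + e.parts.2.cost + 2) (s.scratch (e.eval s)) := by
  refine (Exec.seq (.setR s 0 e.parts.1) (.setR _ 1 e.parts.2)).congr (add_add_add_comm _ _ _ _) ?_
  rw [(CExp.eval_parts _ _).2, (CExp.eval_parts _ _).1]
  have h_eval : e.eval { s with rreg := Function.update s.rreg 0 (e.eval s).re } = e.eval s :=
    CExp.eval_congr (by rfl) (by rfl) (by rfl) (by ext y; simp [State.creg]) e
  rw [h_eval]
  rfl

theorem Op.exec (s : State) (o : Op) : Exec procs o.toCmd s o.cost (o.run s) := by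
  cases o with
  | setN x e => exact .setN s x e
  | storeR a e =>
    exact (Exec.storeR s a e.parts.1).congr rfl (by rw [(e.eval_parts s).1]; rfl)
  | setC x e =>
    refine (Exec.seq (e.exec_toScratch s) (.seq (.setR _ (2 * x + 2) (.reg 0))
      (.setR _ (2 * x + 3) (.reg 1)))).congr (by simp only [RExp.cost, cost]) ?_
    simp [RExp.eval, run, State.setC, State.scratch]
  | storeC a e =>
    refine (Exec.seq (e.exec_toScratch s) (.seq (.storeR _ (.add a a) (.reg 0))
      (.storeR _ (.add (.add a a) (.const 1)) (.reg 1)))).congr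
        (by simp only [RExp.cost, NExp.cost, cost]; lia) ?_
    have h_addr (rr rm : ℕ → ℝ) : a.eval ⟨s.nreg, s.nmem, rr, rm⟩ = a.eval s :=
      NExp.eval_congr (by rfl) (by rfl) a
    simp [NExp.eval, RExp.eval, h_addr, run, State.storeC, State.scratch, ← two_mul]

/-- Straight-line programs. -/
def block : List Op → Cmd
  | [] => .skip
  | o :: l => .seq o.toCmd (block l)

/-- The number of steps taken by a straight-line program. -/
def blockCost : List Op → ℕ
  | [] => 1
  | o :: l => o.cost + blockCost l

/-- The effect of a straight-line program. -/
noncomputable def blockRun : List Op → State → State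
  | [], s => s
  | o :: l, s => blockRun l (o.run s)

theorem block_exec (l : List Op) (s : State) :
    Exec procs (block l) s (blockCost l) (blockRun l s) := by
  induction l generalizing s with
  | nil => exact .skip s
  | cons o l ih => exact (o.exec s).seq (ih _)

theorem blockRun_append (l l' : List Op) (s : State) :
    blockRun (l ++ l') s = blockRun l' (blockRun l s) := by
  induction l generalizing s with
  | nil => rfl
  | cons o _ ih => exact ih _

end Exec

/-! ### Program logic -/

/-- A Hoare triple: started in a state satisfying `P`, the command `c` halts within `B` steps in a
state satisfying `Q`. -/
def Triple (procs : List Cmd) (P : State → Prop) (c : Cmd) (B : ℕ) (Q : State → Prop) : Prop :=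
  ∀ s, P s → ∃ t s', t ≤ B ∧ Exec procs c s t s' ∧ Q s'

namespace Triple

variable {procs : List Cmd} {P Q R : State → Prop} {b : BExp} {c d : Cmd} {B B' : ℕ}

theorem mono (h : Triple procs P c B Q) (hB : B ≤ B') : Triple procs P c B' Q := fun s hs =>
  let ⟨t, s', ht, hc, hQ⟩ := h s hs
  ⟨t, s', ht.trans hB, hc, hQ⟩

theorem conseq {P' Q' : State → Prop} (h : Triple procs P c B Q) (hP : ∀ s, P' s → P s)
    (hQ : ∀ s, Q s → Q' s) : Triple procs P' c B Q' := fun s hs =>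
  let ⟨t, s', ht, hc, h_end⟩ := h s (hP s hs)
  ⟨t, s', ht, hc, hQ s' h_end⟩

theorem seq (hc : Triple procs P c B Q) (hd : Triple procs Q d B' R) :
    Triple procs P (.seq c d) (B + B') R := fun s hs =>
  let ⟨t, s', ht, h_exec, hQ⟩ := hc s hs
  let ⟨t', s'', ht', h_exec', hR⟩ := hd s' hQ
  ⟨t + t', s'', Nat.add_le_add ht ht', h_exec.seq h_exec', hR⟩

theorem ite_true (hb : ∀ s, P s → b.holds s) (hc : Triple procs P c B Q) :
    Triple procs P (.ite b c d) (b.cost + B + 1) Q := fun s hs =>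
  let ⟨t, s', ht, h_exec, hQ⟩ := hc s hs
  ⟨b.cost + t + 1, s', by lia, .ite_true (hb s hs) h_exec, hQ⟩

theorem ite_false (hb : ∀ s, P s → ¬ b.holds s) (hd : Triple procs P d B Q) :
    Triple procs P (.ite b c d) (b.cost + B + 1) Q := fun s hs =>
  let ⟨t, s', ht, h_exec, hQ⟩ := hd s hs
  ⟨b.cost + t + 1, s', by lia, .ite_false (hb s hs) h_exec, hQ⟩

theorem call {i : ℕ} (hi : procs[i]? = some c) (hc : Triple procs P c B Q) :
    Triple procs P (.call i) (B + 1) Q := fun s hs =>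
  let ⟨t, s', ht, h_exec, hQ⟩ := hc s hs
  ⟨t + 1, s', by lia, .call hi h_exec, hQ⟩

theorem block {l : List Op} (h : ∀ s, P s → Q (blockRun l s)) :
    Triple procs P (block l) (blockCost l) Q := fun s hs =>
  ⟨blockCost l, blockRun l s, le_rfl, block_exec l s, h s hs⟩

theorem counted_while {N : ℕ} (I : ℕ → State → Prop)
    (hb : ∀ k ≤ N, ∀ s, I k s → (b.holds s ↔ k < N))
    (h_step : ∀ k < N, Triple procs (I k) c B (I (k + 1))) :
    Triple procs (I 0) (.while b c) (N * (b.cost + B + 1) + (b.cost + 1)) (I N) := by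
  suffices h_rest : ∀ m k, m + k = N →
      Triple procs (I k) (.while b c) (m * (b.cost + B + 1) + (b.cost + 1)) (I N) from
    h_rest N 0 rfl
  intro m
  induction m with
  | zero =>
    intro k hk s hs
    obtain rfl : k = N := by lia
    exact ⟨b.cost + 1, s, by lia, .while_false (by simp [hb k le_rfl s hs]), hs⟩
  | succ m ih =>
    intro k hk s hs
    obtain ⟨t, s', ht, h_exec, hs'⟩ := h_step k (by lia) s hs
    obtain ⟨t', s'', ht', h_exec', hs''⟩ := ih (k + 1) (by lia) s' hs'
    refine ⟨b.cost + t + t' + 1, s'', ?_, .while_true ((hb k (by lia) s hs).2 (by lia)) h_exec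
      h_exec', hs''⟩
    rw [add_mul]
    lia

end Triple

/-! ### The multiplication procedure -/

/-- The register of the input `n`. -/
@[simp] abbrev sizeReg : ℕ := 0

/-- The register of the address of a block of cells. -/
@[simp] abbrev baseReg : ℕ := 1

/-- The register of the length of a block of cells. -/
@[simp] abbrev lenReg : ℕ := 2

/-- The register of the loop counter. -/
@[simp] abbrev ctrReg : ℕ := 3

/-- The complex register of the lower cell of a pair. -/
@[simp] abbrev lowReg : ℕ := 0

/-- The complex register of the upper cell of a pair. -/
@[simp] abbrev highReg : ℕ := 1

/-- The complex register of the number `c` in the modulus `X ^ m - c`. -/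
@[simp] abbrev modReg : ℕ := 2

/-- The loop running `l` while the counter is less than the content of register `lim`. -/
def forLoop (lim : ℕ) (l : List Op) : Cmd :=
  .seq (block [.setN ctrReg (.const 0)])
    (.while (.nle (.add (.reg ctrReg) (.const 1)) (.reg lim))
      (block (l ++ [.setN ctrReg (.add (.reg ctrReg) (.const 1))])))

/-- A bound for the cost of one step of `forLoop`. -/
def forCost (l : List Op) : ℕ := blockCost l + 20

theorem blockCost_append (l l' : List Op) :
    blockCost (l ++ l') + 1 = blockCost l + blockCost l' := by
  induction l with
  | nil => exact add_comm _ _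
  | cons o l ih => simp only [List.cons_append, blockCost]; lia

theorem Triple.forLoop {procs : List Cmd} {lim N : ℕ} {l : List Op}
    (I : ℕ → State → Prop) (hN : ∀ k s, I k s → s.nreg lim = N)
    (h_ctr : ∀ k s v, I k s → I k (s.setN ctrReg v))
    (h_step : ∀ k < N, ∀ s, s.nreg ctrReg = k → I k s →
      (blockRun l s).nreg ctrReg = k ∧ I (k + 1) (blockRun l s)) :
    Triple procs (I 0) (forLoop lim l) ((N + 1) * forCost l) (I N) := by
  have h_init : Triple procs (I 0) (RealRAM.block [.setN ctrReg (.const 0)]) _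
      fun s => s.nreg ctrReg = 0 ∧ I 0 s :=
    Triple.block fun s hs => by simpa [blockRun, Op.run, NExp.eval] using h_ctr _ _ 0 hs
  have h_while := Triple.counted_while (procs := procs) (N := N)
    (b := .nle (.add (.reg ctrReg) (.const 1)) (.reg lim))
    (I := fun k s => s.nreg ctrReg = k ∧ I k s)
    (fun k _ s ⟨hk, hs⟩ => by
      rw [← hN k s hs, ← hk]
      simp only [BExp.holds, NExp.eval]
      exact Nat.succ_le_iff)
    fun k hk => Triple.block (l := l ++ [.setN ctrReg (.add (.reg ctrReg) (.const 1))])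
      fun s ⟨hs_ctr, hs⟩ => by
        obtain ⟨h_ctr', h_next⟩ := h_step k hk s hs_ctr hs
        rw [blockRun_append]
        exact ⟨by simp_all [blockRun, Op.run, NExp.eval], h_ctr _ _ _ h_next⟩
  refine ((h_init.seq h_while).conseq (fun _ => id) fun _ => And.right).mono ?_
  have h_cost := blockCost_append l [.setN ctrReg (.add (.reg ctrReg) (.const 1))]
  simp only [blockCost, Op.cost, NExp.cost, BExp.cost, forCost] at h_cost ⊢
  nlinarith

/-- The states met by the multiplication procedure: `O` and `L` describe the block being worked on,
`c` is the current modulus and `M` the memory, and whatever the procedure does not use is as in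
`s₀`. -/
structure Frame (s₀ : State) (O L : ℕ) (c : ℂ) (M : ℕ → ℂ) (s : State) : Prop where
  size : s.nreg sizeReg = s₀.nreg sizeReg
  base : s.nreg baseReg = O
  len : s.nreg lenReg = L
  creg : ∀ x, s.creg (x + 3) = s₀.creg (x + 3)
  modulus : s.creg modReg = c
  mem : s.cmem = M

/-- The loop body replacing a pair of cells by the values of `f` and `g`, expressions in the
registers `lowReg` and `highReg`. -/
def pairOps (f g : CExp) : List Op :=
  let low := NExp.add (.reg baseReg) (.reg ctrReg)
  let high := NExp.add (.add (.reg baseReg) (.reg lenReg)) (.reg ctrReg)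
  [.setC lowReg (.load low), .setC highReg (.load high), .storeC low f, .storeC high g]

theorem pairLoop_triple {procs : List Cmd} {s₀ : State} {O H : ℕ} {w : ℂ} {M : ℕ → ℂ}
    {f g : CExp} {F G : ℂ → ℂ → ℂ}
    (hf : ∀ s, s.creg modReg = w → f.eval s = F (s.creg lowReg) (s.creg highReg))
    (hg : ∀ s, s.creg modReg = w → g.eval s = G (s.creg lowReg) (s.creg highReg)) :
    Triple procs (Frame s₀ O H w M) (forLoop lenReg (pairOps f g))
      ((H + 1) * forCost (pairOps f g)) (Frame s₀ O H w (pairMap F G O H H M)) := by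
  have h_loop := Triple.forLoop (procs := procs) (lim := lenReg) (l := pairOps f g)
    (N := H) (fun k => Frame s₀ O H w (pairMap F G O H k M)) (fun _ _ hs => hs.len)
    (fun _ _ _ ⟨h_size, h_base, h_len, h_creg, h_mod, h_mem⟩ =>
      ⟨by simpa using h_size, by simpa using h_base, by simpa using h_len, h_creg, h_mod, h_mem⟩)
    fun k hk s h_ctr ⟨h_size, h_base, h_len, h_creg, h_mod, h_mem⟩ => by
      have h_low : pairMap F G O H k M (O + k) = M (O + k) := pairMap_of_notMem (by lia) (by lia)
      have h_high : pairMap F G O H k M (O + H + k) = M (O + H + k) :=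
        pairMap_of_notMem (by lia) (by lia)
      refine ⟨by simpa [pairOps, blockRun, Op.run] using h_ctr, ?_, ?_, ?_, fun x => ?_, ?_, ?_⟩
      · simpa [pairOps, blockRun, Op.run] using h_size
      · simpa [pairOps, blockRun, Op.run] using h_base
      · simpa [pairOps, blockRun, Op.run] using h_len
      · simpa [pairOps, blockRun, Op.run] using h_creg x
      · simpa [pairOps, blockRun, Op.run] using h_mod
      · rw [pairMap_succ hk]
        simp_all [pairOps, blockRun, Op.run, NExp.eval, CExp.eval]
  rwa [pairMap_zero] at h_loop

/-- The instructions for `butterfly`. -/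
def butterflyOps : List Op :=
  pairOps (.add (.reg lowReg) (.mul (.reg modReg) (.reg highReg)))
    (.sub (.reg lowReg) (.mul (.reg modReg) (.reg highReg)))

/-- The instructions for `unbutterfly`. -/
def unbutterflyOps : List Op :=
  pairOps (.div (.add (.reg lowReg) (.reg highReg)) (.const 2))
    (.div (.sub (.reg lowReg) (.reg highReg)) (.add (.reg modReg) (.reg modReg)))

/-- The multiplication of two constants. -/
def mulConstOps : List Op :=
  [.storeC (.reg baseReg) (.mul (.load (.reg baseReg)) (.load (.add (.reg baseReg) (.const 1))))]

/-- Halving the block and passing to the modulus `X ^ m - √c`. -/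
def splitOps : List Op :=
  [.setN lenReg (.half (.reg lenReg)), .setC modReg (.csqrt (.reg modReg))]

/-- Moving to the second half and to the modulus `X ^ m + √c`. -/
def nextHalfOps : List Op :=
  [.setN baseReg (.add (.reg baseReg) (.reg lenReg)),
    .setC modReg (.sub (.const 0) (.reg modReg))]

/-- Moving back to the first half and to the modulus `X ^ m - √c`. -/
def prevHalfOps : List Op :=
  [.setN baseReg (.sub (.reg baseReg) (.reg lenReg)),
    .setC modReg (.sub (.const 0) (.reg modReg))]

/-- Undoing `splitOps`. -/
def mergeOps : List Op :=
  [.setN lenReg (.add (.reg lenReg) (.reg lenReg)), .setC modReg (.mul (.reg modReg) (.reg modReg))]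

/-- The recursive procedure for `polyMul`. It keeps no stack: each call restores the block and the
modulus it was given, the latter by squaring. -/
def polyMulProc : Cmd :=
  .ite (.nle (.reg lenReg) (.const 2)) (block mulConstOps)
    (.seq (block splitOps) <| .seq (forLoop lenReg butterflyOps) <| .seq (.call 0) <|
      .seq (block nextHalfOps) <| .seq (.call 0) <| .seq (block prevHalfOps) <|
      .seq (forLoop lenReg unbutterflyOps) (block mergeOps))

/-- A bound for the cost of `polyMulProc` apart from its loops and calls. -/
def polyMulOverhead : ℕ :=
  blockCost mulConstOps + blockCost splitOps + blockCost nextHalfOps + blockCost prevHalfOps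
    + blockCost mergeOps + 10

/-- A bound for the cost of `polyMulProc` on a block of length `2 ^ (k + 1)`. -/
def polyMulCost : ℕ → ℕ
  | 0 => polyMulOverhead
  | k + 1 => 2 * polyMulCost k
      + ((2 ^ (k + 1) + 1) * (forCost butterflyOps + forCost unbutterflyOps) + polyMulOverhead)

theorem polyMulCost_le (k : ℕ) : polyMulCost k
    ≤ (2 * (forCost butterflyOps + forCost unbutterflyOps) + polyMulOverhead)
      * ((k + 1) * 2 ^ k) := by
  induction k with
  | zero => simp [polyMulCost]
  | succ k ih =>
    have h_one : 1 ≤ 2 ^ k := Nat.one_le_two_pow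
    rw [polyMulCost, pow_succ]
    generalize forCost butterflyOps + forCost unbutterflyOps = D at *
    generalize polyMulOverhead = E at *
    generalize 2 ^ k = m at *
    calc 2 * polyMulCost k + ((m * 2 + 1) * D + E)
        ≤ 2 * ((2 * D + E) * ((k + 1) * m)) + ((m * 2 + m * 2) * D + m * 2 * E) := by
          gcongr <;> nlinarith
      _ = _ := by ring

section Frame

variable {procs : List Cmd} {s₀ : State} {O H k : ℕ} {c w : ℂ} {M : ℕ → ℂ}

theorem mulConst_triple : Triple procs (Frame s₀ O H c M) (block mulConstOps)
    (blockCost mulConstOps) (Frame s₀ O H c (polyMul 0 c O M)) :=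
  Triple.block fun s ⟨h_size, h_base, h_len, h_creg, h_mod, h_mem⟩ => by
    constructor <;> simp_all [mulConstOps, blockRun, Op.run, NExp.eval, CExp.eval, polyMul]

theorem split_triple : Triple procs (Frame s₀ O (2 * H) c M) (block splitOps)
    (blockCost splitOps) (Frame s₀ O H (csqrt c) M) :=
  Triple.block fun s ⟨h_size, h_base, h_len, h_creg, h_mod, h_mem⟩ => by
    constructor <;> simp_all [splitOps, blockRun, Op.run, NExp.eval, CExp.eval]

theorem nextHalf_triple : Triple procs (Frame s₀ O H w M) (block nextHalfOps)
    (blockCost nextHalfOps) (Frame s₀ (O + H) H (-w) M) :=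
  Triple.block fun s ⟨h_size, h_base, h_len, h_creg, h_mod, h_mem⟩ => by
    constructor <;> simp_all [nextHalfOps, blockRun, Op.run, NExp.eval, CExp.eval]

theorem prevHalf_triple : Triple procs (Frame s₀ (O + H) H (-w) M) (block prevHalfOps)
    (blockCost prevHalfOps) (Frame s₀ O H w M) :=
  Triple.block fun s ⟨h_size, h_base, h_len, h_creg, h_mod, h_mem⟩ => by
    constructor <;> simp_all [prevHalfOps, blockRun, Op.run, NExp.eval, CExp.eval]

theorem merge_triple : Triple procs (Frame s₀ O H w M) (block mergeOps)
    (blockCost mergeOps) (Frame s₀ O (2 * H) (w * w) M) :=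
  Triple.block fun s ⟨h_size, h_base, h_len, h_creg, h_mod, h_mem⟩ => by
    constructor <;> simp_all [mergeOps, blockRun, Op.run, NExp.eval, CExp.eval, two_mul]

theorem butterfly_triple : Triple procs (Frame s₀ O H w M) (forLoop lenReg butterflyOps)
    ((H + 1) * forCost butterflyOps) (Frame s₀ O H w (butterfly w O H H M)) :=
  pairLoop_triple (fun s hs => by simp [CExp.eval, ← hs]) fun s hs => by simp [CExp.eval, ← hs]

theorem unbutterfly_triple : Triple procs (Frame s₀ O H w M) (forLoop lenReg unbutterflyOps)
    ((H + 1) * forCost unbutterflyOps) (Frame s₀ O H w (unbutterfly w O H H M)) :=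
  pairLoop_triple (fun _ _ => by simp [CExp.eval]) fun s hs => by simp [CExp.eval, ← hs]

theorem polyMul_triple (k : ℕ) (hc : c.im ≠ 0) :
    Triple [polyMulProc] (Frame s₀ O (2 ^ (k + 1)) c M) polyMulProc (polyMulCost k)
      (Frame s₀ O (2 ^ (k + 1)) c (polyMul k c O M)) := by
  induction k generalizing O c M with
  | zero =>
    refine (Triple.ite_true (fun s hs => ?_) mulConst_triple).mono ?_
    · simp [BExp.holds, NExp.eval, hs.len]
    · simp only [BExp.cost, NExp.cost, polyMulCost, polyMulOverhead]
      lia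
  | succ k ih =>
    have h_sq : csqrt c * csqrt c = c := csqrt_mul_self (.inr hc)
    have h_im : (csqrt c).im ≠ 0 := csqrt_im_ne_zero hc
    have h_call {O : ℕ} {w : ℂ} (hw : w.im ≠ 0) {M : ℕ → ℂ} :=
      Triple.call (i := 0) rfl (ih (O := O) (M := M) hw)
    have h_body := (split_triple (M := M) (O := O)).seq <| butterfly_triple.seq <|
      (h_call h_im).seq <|
      nextHalf_triple.seq <| (h_call (by simpa using h_im)).seq <| prevHalf_triple.seq <|
      unbutterfly_triple.seq merge_triple
    rw [h_sq, ← pow_succ'] at h_body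
    refine (Triple.ite_false (fun s hs => ?_) h_body).mono ?_
    · have h_one : 1 ≤ 2 ^ k := Nat.one_le_two_pow
      simp only [BExp.holds, NExp.eval, hs.len, pow_succ]
      lia
    · simp only [BExp.cost, NExp.cost, polyMulCost, polyMulOverhead]
      rw [_root_.mul_add]
      lia

end Frame

end RealRAM

namespace RealRAM

open FFTMech Finset

/-! ### Loops over powers of the root of unity -/

/-- The complex register of `zeta n`. -/
@[simp] abbrev rootReg : ℕ := 3

/-- The complex register of `zeta n ^ j`. -/
@[simp] abbrev powReg : ℕ := 4

/-- The complex register of `zeta n ^ j ^ 2`. -/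
@[simp] abbrev sqReg : ℕ := 5

/-- The complex register of `zeta (2 * n) ^ (2 * j + 1)`. -/
@[simp] abbrev halfReg : ℕ := 6

/-- The complex register of the number `n`. -/
@[simp] abbrev cntReg : ℕ := 7

/-- The complex register of the sum of the input. -/
@[simp] abbrev inputSumReg : ℕ := 8

/-- The complex register of the partial sums of the negacyclic solution. -/
@[simp] abbrev solSumReg : ℕ := 9

/-- The complex register of the partial sums of the correction and of its coefficient. -/
@[simp] abbrev corrReg : ℕ := 10

/-- The states met between the loops of the decoder: `O` and `L` describe a block of cells, `c`,
`b`, `x`, `u` are the contents of the registers from `cntReg` to `corrReg`, and the real memory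
satisfies `R`. -/
structure Stage (n O L : ℕ) (c b x u : ℂ) (R : (ℕ → ℝ) → Prop) (s : State) : Prop where
  size : s.nreg sizeReg = n
  base : s.nreg baseReg = O
  len : s.nreg lenReg = L
  root : s.creg rootReg = zeta n
  cnt : s.creg cntReg = c
  inputSum : s.creg inputSumReg = b
  solSum : s.creg solSumReg = x
  corr : s.creg corrReg = u
  mem : R s.rmem

/-- The powers of roots of unity available in step `j` of a `chirpLoop`. -/
structure Chirp (n j : ℕ) (s : State) : Prop where
  pow : s.creg powReg = zeta n ^ j
  sq : s.creg sqReg = zeta n ^ j ^ 2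
  half : s.creg halfReg = zeta (2 * n) ^ (2 * j + 1)

/-- The states met inside step `j` of a `chirpLoop`. -/
structure ChirpStage (n O L j : ℕ) (c b x u : ℂ) (R : (ℕ → ℝ) → Prop) (s : State) : Prop extends
    Stage n O L c b x u R s, Chirp n j s where
  ctr : s.nreg ctrReg = j

/-- The initial powers. -/
def chirpInitOps : List Op :=
  [.setC powReg (.const 1), .setC sqReg (.const 1), .setC halfReg (.root (.add (.reg sizeReg)
    (.reg sizeReg)))]

/-- Passing to the next powers, by `(j + 1) ^ 2 = j ^ 2 + 2 * j + 1`. -/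
def chirpStepOps : List Op :=
  [.setC sqReg (.mul (.mul (.mul (.reg sqReg) (.reg powReg)) (.reg powReg)) (.reg rootReg)),
    .setC powReg (.mul (.reg powReg) (.reg rootReg)),
    .setC halfReg (.mul (.reg halfReg) (.reg rootReg))]

/-- The loop running `l` for `j = 0, …, n - 1` with powers of roots of unity at hand. -/
def chirpLoop (l : List Op) : Cmd :=
  .seq (block chirpInitOps) (forLoop sizeReg (l ++ chirpStepOps))

/-- A bound for the cost of one step of `chirpLoop`. -/
def chirpCost (l : List Op) : ℕ := blockCost chirpInitOps + forCost (l ++ chirpStepOps)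

section Stage

variable {n O L j : ℕ} {c b x u : ℂ} {R : (ℕ → ℝ) → Prop} {s : State}

theorem Stage.imp {R' : (ℕ → ℝ) → Prop} (hs : Stage n O L c b x u R s) (h : R s.rmem → R' s.rmem) :
    Stage n O L c b x u R' s :=
  { hs with mem := h hs.mem }

theorem Stage.setN_ctr (hs : Stage n O L c b x u R s) (v : ℕ) :
    Stage n O L c b x u R (s.setN ctrReg v) :=
  ⟨by simpa using hs.size, by simpa using hs.base, by simpa using hs.len, hs.root, hs.cnt,
    hs.inputSum, hs.solSum, hs.corr, hs.mem⟩

theorem ChirpStage.storeC {R' : (ℕ → ℝ) → Prop} (hs : ChirpStage n O L j c b x u R s) {a : ℕ}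
    {v : ℂ} (hR : R' (s.storeC a v).rmem) : ChirpStage n O L j c b x u R' (s.storeC a v) := by
  obtain ⟨⟨h_size, h_base, h_len, h_root, h_cnt, h_in, h_sol, h_corr, -⟩, ⟨h_pow, h_sq, h_half⟩,
    h_ctr⟩ := hs
  constructor <;> [constructor; constructor; skip] <;> simp_all

theorem ChirpStage.storeR {R' : (ℕ → ℝ) → Prop} (hs : ChirpStage n O L j c b x u R s) {a : ℕ}
    {r : ℝ} (hR : R' (Function.update s.rmem a r)) :
    ChirpStage n O L j c b x u R' (s.storeR a r) := by
  obtain ⟨⟨h_size, h_base, h_len, h_root, h_cnt, h_in, h_sol, h_corr, -⟩, ⟨h_pow, h_sq, h_half⟩,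
    h_ctr⟩ := hs
  constructor <;> [constructor; constructor; skip] <;> simp_all

theorem ChirpStage.setC_solSum (hs : ChirpStage n O L j c b x u R s) (v : ℂ) :
    ChirpStage n O L j c b v u R (s.setC solSumReg v) := by
  obtain ⟨⟨h_size, h_base, h_len, h_root, h_cnt, h_in, -, h_corr, h_mem⟩,
    ⟨h_pow, h_sq, h_half⟩, h_ctr⟩ := hs
  constructor <;> [constructor; constructor; skip] <;> simp_all

theorem ChirpStage.setC_corr (hs : ChirpStage n O L j c b x u R s) (v : ℂ) :
    ChirpStage n O L j c b x v R (s.setC corrReg v) := by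
  obtain ⟨⟨h_size, h_base, h_len, h_root, h_cnt, h_in, h_sol, -, h_mem⟩,
    ⟨h_pow, h_sq, h_half⟩, h_ctr⟩ := hs
  constructor <;> [constructor; constructor; skip] <;> simp_all

theorem chirpInit_run (hs : Stage n O L c b x u R s) :
    Stage n O L c b x u R (blockRun chirpInitOps s) ∧ Chirp n 0 (blockRun chirpInitOps s) := by
  obtain ⟨h_size, h_base, h_len, h_root, h_cnt, h_in, h_sol, h_corr, h_mem⟩ := hs
  refine ⟨?_, ?_⟩ <;> constructor <;>
    simp_all [chirpInitOps, blockRun, Op.run, NExp.eval, CExp.eval, two_mul]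

theorem chirpStep_run (hs : ChirpStage n O L j c b x u R s) :
    ((blockRun chirpStepOps s).nreg ctrReg = j ∧ Chirp n (j + 1) (blockRun chirpStepOps s))
      ∧ Stage n O L c b x u R (blockRun chirpStepOps s) := by
  obtain ⟨⟨h_size, h_base, h_len, h_root, h_cnt, h_in, h_sol, h_corr, h_mem⟩,
    ⟨h_pow, h_sq, h_half⟩, h_ctr⟩ := hs
  refine ⟨⟨?_, ?_⟩, ?_⟩
  · simpa [chirpStepOps, blockRun, Op.run] using h_ctr
  · have h_next_sq : zeta n ^ (j + 1) ^ 2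
        = zeta n ^ j ^ 2 * zeta n ^ j * zeta n ^ j * zeta n := by ring
    have h_next_half : zeta (2 * n) ^ (2 * (j + 1) + 1)
        = zeta (2 * n) ^ (2 * j + 1) * zeta n := by
      rw [← zeta_two_mul_sq n]
      ring
    constructor
    · simp [chirpStepOps, blockRun, Op.run, CExp.eval, h_pow, h_root, pow_succ]
    · simp [chirpStepOps, blockRun, Op.run, CExp.eval, h_sq, h_pow, h_root, h_next_sq]
    · simp [chirpStepOps, blockRun, Op.run, CExp.eval, h_half, h_root, h_next_half]
  · constructor <;> simp_all [chirpStepOps, blockRun, Op.run]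

theorem chirpLoop_triple {procs : List Cmd} {l : List Op} {x u : ℕ → ℂ}
    {R : ℕ → (ℕ → ℝ) → Prop}
    (h_step : ∀ k < n, ∀ s, ChirpStage n O L k c b (x k) (u k) (R k) s →
      ChirpStage n O L k c b (x (k + 1)) (u (k + 1)) (R (k + 1)) (blockRun l s)) :
    Triple procs (Stage n O L c b (x 0) (u 0) (R 0)) (chirpLoop l) ((n + 1) * chirpCost l)
      (Stage n O L c b (x n) (u n) (R n)) := by
  have h_init : Triple procs (Stage n O L c b (x 0) (u 0) (R 0)) (block chirpInitOps) _
      fun s => Stage n O L c b (x 0) (u 0) (R 0) s ∧ Chirp n 0 s :=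
    Triple.block fun _ => chirpInit_run
  have h_loop := Triple.forLoop (procs := procs) (lim := sizeReg) (N := n) (l := l ++ chirpStepOps)
    (fun k s => Stage n O L c b (x k) (u k) (R k) s ∧ Chirp n k s) (fun _ _ hs => hs.1.size)
    (fun _ _ v hs => ⟨hs.1.setN_ctr v, hs.2.pow, hs.2.sq, hs.2.half⟩)
    fun k hk s h_ctr hs => by
      have h_next := chirpStep_run (h_step k hk s ⟨hs.1, hs.2, h_ctr⟩)
      rw [blockRun_append]
      exact ⟨h_next.1.1, h_next.2, h_next.1.2⟩
  refine ((h_init.seq h_loop).conseq (fun _ => id) fun _ => And.left).mono ?_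
  rw [chirpCost]
  nlinarith

end Stage

/-! ### The convolution phase -/

/-- One step of `load`, with the values of `a` and `f`. -/
def loadOps (a f : CExp) : List Op :=
  let high := NExp.add (.reg sizeReg) (.reg ctrReg)
  let low := NExp.sub (.reg sizeReg) (.reg ctrReg)
  [.storeC (.add (.reg baseReg) (.add (.reg ctrReg) (.reg ctrReg))) a,
    .storeC (.add (.add (.reg baseReg) (.add high high)) (.const 1)) f,
    .storeC (.add (.add (.reg baseReg) (.add low low)) (.const 1)) f]

/-- The computation of `evenConv`: writing the values of `a` and `f` into the block and multiplying
modulo `X ^ 2 ^ k - I`. -/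
def convPhase (a f : CExp) : Cmd :=
  .seq (chirpLoop (loadOps a f)) (.seq (block [.setC modReg .I]) (.call 0))

/-- A bound for the cost of `convPhase` with a block of length `2 ^ (k + 1)`. -/
def convCost (n k : ℕ) (a f : CExp) : ℕ :=
  (n + 1) * chirpCost (loadOps a f) + (blockCost [.setC modReg .I] + (polyMulCost k + 1))

section convPhase

variable {n O L k : ℕ} {c b x u : ℂ} {a f : CExp} {A F M : ℕ → ℂ}

theorem load_triple {procs : List Cmd}
    (ha : ∀ j < n, ∀ s, ChirpStage n O L j c b x u (fun m => ∀ y < O, cells m y = M y) s →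
      a.eval s = A j)
    (hf : ∀ j < n, ∀ s, ChirpStage n O L j c b x u (fun m => ∀ y < O, cells m y = M y) s →
      f.eval s = F j) :
    Triple procs (Stage n O L c b x u fun m => cells m = M) (chirpLoop (loadOps a f))
      ((n + 1) * chirpCost (loadOps a f))
      (Stage n O L c b x u fun m => cells m = load n O A F n M) := by
  refine chirpLoop_triple (x := fun _ => x) (u := fun _ => u)
    (R := fun k m => cells m = load n O A F k M) fun j hj s hs => ?_
  have h_below : ChirpStage n O L j c b x u (fun m => ∀ y < O, cells m y = M y) s :=
    { hs with mem := fun y hy => by rw [hs.mem, load_of_notMem hj.le (.inl hy)] }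
  have h_store {s : State} {y : ℕ} (v : ℂ) (hy : O ≤ y)
      (hs : ChirpStage n O L j c b x u (fun m => ∀ y < O, cells m y = M y) s) :
      ChirpStage n O L j c b x u (fun m => ∀ y < O, cells m y = M y) (s.storeC y v) :=
    hs.storeC fun z hz => by
      change (s.storeC y v).cmem z = M z
      rw [State.cmem_storeC, Function.update_of_ne (by lia)]
      exact hs.mem z hz
  have h_first := h_store (A j) (Nat.le_add_right O (j + j)) h_below
  have h_second := h_store (y := O + ((n + j) + (n + j)) + 1) (F j) (by lia) h_first
  have h_run : blockRun (loadOps a f) s = ((s.storeC (O + (j + j)) (A j)).storeC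
      (O + ((n + j) + (n + j)) + 1) (F j)).storeC (O + ((n - j) + (n - j)) + 1) (F j) := by
    simp only [loadOps, blockRun, Op.run, NExp.eval, ha j hj s h_below, hs.base, hs.ctr,
      hf j hj _ h_first, h_first.size, h_first.base, h_first.ctr, hf j hj _ h_second,
      h_second.size, h_second.base, h_second.ctr]
  rw [h_run]
  refine h_second.storeC ?_
  change State.cmem _ = _
  have h_mem : s.cmem = load n O A F j M := hs.mem
  simp only [State.cmem_storeC, h_mem, load, two_mul]

theorem convPhase_triple (hn : 3 * n ≤ 2 ^ k) (hM : ∀ y, O ≤ y → M y = 0)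
    (ha : ∀ j < n, ∀ s,
      ChirpStage n O (2 ^ (k + 1)) j c b x u (fun m => ∀ y < O, cells m y = M y) s →
      a.eval s = A j)
    (hf : ∀ j < n, ∀ s,
      ChirpStage n O (2 ^ (k + 1)) j c b x u (fun m => ∀ y < O, cells m y = M y) s →
      f.eval s = F j) :
    Triple [polyMulProc] (Stage n O (2 ^ (k + 1)) c b x u fun m => cells m = M) (convPhase a f)
      (convCost n k a f) (Stage n O (2 ^ (k + 1)) c b x u fun m =>
        (∀ i < n, cells m (O + 2 * (n + i)) = evenConv n A F i) ∧
        ∀ y, y < O ∨ O + 2 ^ (k + 1) ≤ y → cells m y = M y) := by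
  have h_mod : Triple [polyMulProc]
      (Stage n O (2 ^ (k + 1)) c b x u fun m => cells m = load n O A F n M)
      (block [.setC modReg .I]) _ fun s => s.creg modReg = Complex.I ∧
        Stage n O (2 ^ (k + 1)) c b x u (fun m => cells m = load n O A F n M) s :=
    Triple.block fun s ⟨h_size, h_base, h_len, h_root, h_cnt, h_in, h_sol, h_corr, h_mem⟩ => by
      refine ⟨?_, ?_⟩ <;> [skip; constructor] <;> simp_all [blockRun, Op.run, CExp.eval]
  have h_mul : Triple [polyMulProc] (fun s => s.creg modReg = Complex.I ∧
        Stage n O (2 ^ (k + 1)) c b x u (fun m => cells m = load n O A F n M) s)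
      polyMulProc (polyMulCost k)
      (Stage n O (2 ^ (k + 1)) c b x u fun m =>
        cells m = polyMul k Complex.I O (load n O A F n M)) := by
    intro s ⟨h_mod, hs⟩
    obtain ⟨t, s', ht, h_exec, h_end⟩ := polyMul_triple k (by simp : Complex.I.im ≠ 0) s
      ⟨rfl, hs.base, hs.len, fun _ => rfl, h_mod, hs.mem⟩
    exact ⟨t, s', ht, h_exec, h_end.size.trans hs.size, h_end.base, h_end.len,
      (h_end.creg 0).trans hs.root, (h_end.creg 4).trans hs.cnt, (h_end.creg 5).trans hs.inputSum,
      (h_end.creg 6).trans hs.solSum, (h_end.creg 7).trans hs.corr, h_end.mem⟩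
  refine ((load_triple ha hf).seq (h_mod.seq (h_mul.call rfl))).conseq (fun _ => id) fun s hs =>
    hs.imp fun hm => ?_
  rw [hm]
  refine ⟨fun i hi => polyMul_load hn (by simp) A F hM hi, fun y hy => ?_⟩
  rw [polyMul_of_notMem _ _ _ _ hy, load_of_notMem le_rfl (by rw [pow_succ] at hy; lia)]

end convPhase

/-! ### The decoder -/

/-- Setting up the root of unity and a block of length `2`. -/
def initOps : List Op :=
  [.setN baseReg (.reg sizeReg), .setN lenReg (.const 2), .setC rootReg (.root (.reg sizeReg))]

/-- Doubling the length of the block. -/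
def growOps : List Op := [.setN lenReg (.add (.reg lenReg) (.reg lenReg))]

/-- Doubling the length of the block until it has room for the convolutions. -/
def growBlock : Cmd :=
  .while (.not (.nle (.add (.reg sizeReg) (.add (.reg sizeReg) (.reg sizeReg)))
    (.half (.reg lenReg)))) (block growOps)

/-- The address of the cell of index `n + j` among the even cells of a block from `base` on. -/
def convCell (base : NExp) : NExp :=
  .add base (.add (.add (.reg sizeReg) (.reg ctrReg)) (.add (.reg sizeReg) (.reg ctrReg)))

/-- Counting up to `n` and adding up the input. -/
def inputSumOps : List Op :=
  [.setC cntReg (.add (.reg cntReg) (.const 1)),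
    .setC inputSumReg (.add (.reg inputSumReg)
      (.add (.cell (.reg ctrReg)) (.cell (.add (.reg sizeReg) (.reg ctrReg)))))]

/-- The factor `negacyclicFold n b j * conj (zeta n ^ (j ^ 2 + j))`. -/
def foldExp : CExp :=
  .mul (.sub (.cell (.reg ctrReg)) (.cell (.add (.reg sizeReg) (.reg ctrReg))))
    (.conj (.mul (.reg sqReg) (.reg powReg)))

/-- The factor `invSqrtEig n j` times the `j`-th entry of the convolution in the previous block. -/
def spectrumExp : CExp :=
  .mul (.csqrt (.div (.sub (.const 1) (.conj (.mul (.mul (.reg powReg) (.reg powReg))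
    (.reg rootReg)))) (.const 2))) (.load (convCell (.sub (.reg baseReg) (.reg lenReg))))

/-- Passing to the next block. -/
def nextBlockOps : List Op := [.setN baseReg (.add (.reg baseReg) (.reg lenReg))]

/-- The computation of `negacyclicSol`, up to a chirp. -/
def solvePhase : Cmd :=
  .seq (convPhase foldExp (.reg sqReg))
    (.seq (block nextBlockOps) (convPhase spectrumExp (.conj (.reg sqReg))))

/-- A bound for the cost of `solvePhase` with blocks of length `2 ^ (k + 1)`. -/
def solveCost (n k : ℕ) : ℕ :=
  convCost n k foldExp (.reg sqReg)
    + (blockCost nextBlockOps + convCost n k spectrumExp (.conj (.reg sqReg)))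

/-- The `j`-th entry of `negacyclicSol`. -/
def solExp : CExp :=
  .div (.mul (.mul (.reg sqReg) (.reg powReg)) (.load (convCell (.reg baseReg)))) (.reg cntReg)

/-- The `j`-th entry of `correction`. -/
def correctionExp : CExp := .div (.const 1) (.mul (.reg cntReg) (.im (.reg halfReg)))

/-- Adding up the negacyclic solution and the correction. -/
def sumOps : List Op :=
  [.setC solSumReg (.add (.reg solSumReg) solExp),
    .setC corrReg (.add (.reg corrReg) correctionExp)]

/-- The computation of `correctionCoeff`. -/
def coeffOps : List Op :=
  [.setC corrReg (.div (.sub (.div (.reg inputSumReg) (.csqrt (.reg cntReg))) (.reg solSumReg))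
    (.add (.const 1) (.reg corrReg))), .setC solSumReg (.const 0)]

/-- Writing the partial sums of `leastSquares` to the output. -/
def outputOps : List Op :=
  [.setC solSumReg (.add (.reg solSumReg) (.add solExp (.mul (.reg corrReg) correctionExp))),
    .storeR (.reg ctrReg) (.reg solSumReg)]

/-- The block at `O` of the memory holds `negacyclicSol n d`, up to the chirp and the factor `n`. -/
def SolStored (n O : ℕ) (d : ℕ → ℂ) (m : ℕ → ℝ) : Prop :=
  ∀ i < n, zeta n ^ (i ^ 2 + i) * cells m (O + 2 * (n + i)) / n = negacyclicSol n d i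

/-- The program evaluating the optimal decoder. The input fills the first `n` complex cells, the
blocks of the two convolutions follow. -/
def decoderProgram : Program where
  main := .seq (block initOps) <| .seq growBlock <| .seq (forLoop sizeReg inputSumOps) <|
    .seq solvePhase <| .seq (chirpLoop sumOps) <| .seq (block coeffOps) (chirpLoop outputOps)
  procs := [polyMulProc]

section decoder

variable {procs : List Cmd} {n O L k : ℕ} {B x u : ℂ} {β : ℕ → ℝ}

theorem growBlock_triple {c b x u : ℂ} {R : (ℕ → ℝ) → Prop} :
    Triple procs (Stage n O 2 c b x u R) growBlock
      (Nat.clog 2 (3 * n) * (blockCost growOps + 10) + 10)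
      (Stage n O (2 ^ (Nat.clog 2 (3 * n) + 1)) c b x u R) := by
  refine (Triple.counted_while (B := blockCost growOps)
    (fun k => Stage n O (2 ^ (k + 1)) c b x u R) (fun k _ s hs => ?_)
    fun k _ => Triple.block fun s hs => ?_).mono ?_
  · simp only [BExp.holds, NExp.eval, hs.size, hs.len, pow_succ, Nat.mul_div_cancel _ two_pos,
      Nat.lt_clog_iff_pow_lt one_lt_two]
    lia
  · obtain ⟨h_size, h_base, h_len, h_root, h_cnt, h_in, h_sol, h_corr, h_mem⟩ := hs
    constructor <;> simp_all [growOps, blockRun, Op.run, NExp.eval, pow_succ, mul_two]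
  · simp only [BExp.cost, NExp.cost]
    lia

theorem inputSum_triple :
    Triple procs (Stage n O L 0 0 x u fun m => cells m = cells β) (forLoop sizeReg inputSumOps)
      ((n + 1) * forCost inputSumOps)
      (Stage n O L n (∑ a ∈ range (2 * n), (β a : ℂ)) x u fun m => cells m = cells β) := by
  have h_loop := Triple.forLoop (procs := procs) (lim := sizeReg) (N := n) (l := inputSumOps)
    (fun k => Stage n O L k (∑ a ∈ range k, ((β a : ℂ) + β (n + a))) x u
      fun m => cells m = cells β)
    (fun _ _ hs => hs.size) (fun _ _ v hs => hs.setN_ctr v) fun k _ s h_ctr hs => by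
      obtain ⟨h_size, h_base, h_len, h_root, h_cnt, h_in, h_sol, h_corr, h_mem⟩ := hs
      have h_cell (j : ℕ) : s.rmem j = β j := eq_of_cells_eq (congrFun h_mem _)
      refine ⟨by simpa [inputSumOps, blockRun, Op.run] using h_ctr, ?_⟩
      constructor <;>
        simp_all [inputSumOps, blockRun, Op.run, NExp.eval, CExp.eval, sum_range_succ]
  rw [two_mul, sum_range_add, ← sum_add_distrib]
  simpa only [Nat.cast_zero, sum_range_zero] using h_loop

theorem foldExp_eval {j : ℕ} (hj : j < n) {c b : ℂ} {s : State}
    (hs : ChirpStage n n L j c b x u (fun m => ∀ y < n, cells m y = cells β y) s) :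
    foldExp.eval s
      = negacyclicFold n (fun a => β a) j * starRingEnd ℂ (zeta n ^ (j ^ 2 + j)) := by
  have h_cell (a : ℕ) (ha : a < 2 * n) : s.rmem a = β a :=
    eq_of_cells_eq (hs.mem _ (by lia))
  simp only [foldExp, CExp.eval, NExp.eval, hs.ctr, hs.size, hs.sq, hs.pow,
    h_cell j (by lia), h_cell (n + j) (by lia), negacyclicFold, pow_add]

theorem spectrumExp_eval {A F : ℕ → ℂ} {j : ℕ} (hj : j < n) {c b : ℂ} {s : State} {M : ℕ → ℂ}
    (hM : ∀ i < n, M (O + 2 * (n + i)) = evenConv n A F i) (hL : 4 * n ≤ L)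
    (hs : ChirpStage n (O + L) L j c b x u (fun m => ∀ y < O + L, cells m y = M y) s) :
    spectrumExp.eval s = invSqrtEig n j * evenConv n A F j := by
  have h_load : s.cmem (O + L - L + (n + j + (n + j))) = evenConv n A F j := by
    rw [Nat.add_sub_cancel, ← two_mul, ← hM j hj]
    exact hs.mem _ (by lia)
  simp only [spectrumExp, convCell, CExp.eval, NExp.eval, hs.ctr, hs.size, hs.pow, hs.root, hs.base,
    hs.len, h_load, invSqrtEig, Int.cast_one, Int.cast_ofNat, ← pow_add, ← pow_succ, two_mul]

theorem nextBlock_triple {c b x u : ℂ} {R : (ℕ → ℝ) → Prop} :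
    Triple procs (Stage n O L c b x u R) (block nextBlockOps) (blockCost nextBlockOps)
      (Stage n (O + L) L c b x u R) :=
  Triple.block fun s ⟨h_size, h_base, h_len, h_root, h_cnt, h_in, h_sol, h_corr, h_mem⟩ => by
    constructor <;> simp_all [nextBlockOps, blockRun, Op.run, NExp.eval]

theorem solve_triple (hn : 3 * n ≤ 2 ^ k) (hβ : ∀ a, 2 * n ≤ a → β a = 0) :
    Triple [polyMulProc] (Stage n n (2 ^ (k + 1)) n B 0 0 fun m => cells m = cells β) solvePhase
      (solveCost n k)
      (Stage n (n + 2 ^ (k + 1)) (2 ^ (k + 1)) n B 0 0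
        (SolStored n (n + 2 ^ (k + 1)) (negacyclicFold n fun a => β a))) := by
  have hM (y : ℕ) (hy : n ≤ y) : cells β y = 0 := by
    simp [cells, hβ (2 * y) (by lia), hβ (2 * y + 1) (by lia), Complex.ext_iff]
  have h_fold := convPhase_triple (f := .reg sqReg) (c := n) (b := B) (x := 0) (u := 0) hn hM
    (fun j hj _ hs => foldExp_eval hj hs) fun _ _ _ hs => hs.sq
  refine h_fold.seq (nextBlock_triple.seq fun s hs => ?_)
  obtain ⟨hs_conv, hs_zero⟩ := hs.mem
  have h_spectrum := convPhase_triple (O := n + 2 ^ (k + 1)) (M := s.cmem) (c := n) (b := B)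
    (x := 0) (u := 0) (f := .conj (.reg sqReg)) (F := fun e => starRingEnd ℂ (zeta n ^ e ^ 2)) hn
    (fun y hy => (hs_zero y (.inr hy)).trans (hM y (by lia)))
    (fun j hj _ => spectrumExp_eval hj hs_conv (by rw [pow_succ]; lia))
    fun _ _ _ hs => congrArg _ hs.sq
  refine h_spectrum.conseq (fun _ => id) (fun s' hs' => hs'.imp fun h_conv i hi => ?_) s
    (hs.imp fun _ => rfl)
  rw [h_conv.1 i hi, negacyclicSol_eq_evenConv]

theorem solExp_eval {d : ℕ → ℂ} {j : ℕ} (hj : j < n) {s : State}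
    (hs : ChirpStage n O L j n B x u (SolStored n O d) s) :
    solExp.eval s = negacyclicSol n d j := by
  have h_mem : zeta n ^ (j ^ 2 + j) * s.cmem (O + 2 * (n + j)) / n = negacyclicSol n d j :=
    hs.mem j hj
  simp only [solExp, convCell, CExp.eval, NExp.eval, hs.ctr, hs.size, hs.base, hs.cnt, hs.sq,
    hs.pow, ← pow_add, ← two_mul, h_mem]

theorem correctionExp_eval {R : (ℕ → ℝ) → Prop} {j : ℕ} (hj : j < n) {s : State}
    (hs : ChirpStage n O L j n B x u R s) : correctionExp.eval s = correction n j := by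
  simp only [correctionExp, CExp.eval, hs.cnt, hs.half, Int.cast_one, correction_eq hj]

theorem sum_triple {d : ℕ → ℂ} :
    Triple procs (Stage n O L n B 0 0 (SolStored n O d)) (chirpLoop sumOps)
      ((n + 1) * chirpCost sumOps)
      (Stage n O L n B (∑ j ∈ range n, negacyclicSol n d j) (∑ j ∈ range n, correction n j)
        (SolStored n O d)) := by
  refine chirpLoop_triple (x := fun k => ∑ j ∈ range k, negacyclicSol n d j)
    (u := fun k => ∑ j ∈ range k, correction n j) (R := fun _ => SolStored n O d)
    fun k hk s hs => ?_
  have hs_sol := hs.setC_solSum (∑ j ∈ range (k + 1), negacyclicSol n d j)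
  have h_run : blockRun sumOps s
      = (s.setC solSumReg (∑ j ∈ range (k + 1), negacyclicSol n d j)).setC corrReg
        (∑ j ∈ range (k + 1), correction n j) := by
    rw [sum_range_succ] at hs_sol
    simp only [sumOps, blockRun, Op.run, CExp.eval, hs.solSum, solExp_eval hk hs, hs_sol.corr,
      correctionExp_eval hk hs_sol, sum_range_succ]
  rw [h_run]
  exact hs_sol.setC_corr _

theorem coeff_triple {X U : ℂ} {R : (ℕ → ℝ) → Prop} :
    Triple procs (Stage n O L n B X U R) (block coeffOps) (blockCost coeffOps)
      (Stage n O L n B 0 ((B / FFTMech.csqrt n - X) / (1 + U)) R) :=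
  Triple.block fun s ⟨h_size, h_base, h_len, h_root, h_cnt, h_in, h_sol, h_corr, h_mem⟩ => by
    constructor <;> simp_all [coeffOps, blockRun, Op.run, CExp.eval]

theorem cells_update_of_lt {m : ℕ → ℝ} {j y : ℕ} (h : j < 2 * y) (r : ℝ) :
    cells (Function.update m j r) y = cells m y := by
  simp only [cells, Function.update_of_ne (show 2 * y ≠ j by lia),
    Function.update_of_ne (show 2 * y + 1 ≠ j by lia)]

theorem output_triple {d : ℕ → ℂ} {γ : ℂ} (hO : n ≤ O) :
    Triple procs (Stage n O L n B 0 γ (SolStored n O d)) (chirpLoop outputOps)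
      ((n + 1) * chirpCost outputOps)
      fun s => ∀ i < n, s.rmem i
        = ∑ j ∈ range (i + 1), (negacyclicSol n d j + γ * correction n j).re := by
  let X (k : ℕ) : ℂ := ∑ j ∈ range k, (negacyclicSol n d j + γ * correction n j)
  have h_loop := chirpLoop_triple (procs := procs) (n := n) (O := O) (L := L) (c := n) (b := B)
    (x := X) (u := fun _ => γ) (l := outputOps)
    (R := fun k m => SolStored n O d m ∧ ∀ i < k, m i = (X (i + 1)).re) fun k hk s hs => ?_
  · refine h_loop.conseq (fun s hs => hs.imp fun h_mem => ⟨h_mem, by simp⟩) fun s hs i hi => ?_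
    rw [hs.mem.2 i hi, Complex.re_sum]
  have h_run : blockRun outputOps s = (s.setC solSumReg (X (k + 1))).storeR k (X (k + 1)).re := by
    have h_sol := solExp_eval hk { hs with mem := hs.mem.1 }
    simp only [outputOps, blockRun, Op.run, CExp.eval, NExp.eval, hs.solSum, h_sol, hs.corr,
      correctionExp_eval hk hs, State.nreg_setC, hs.ctr, State.creg_setC, Function.update_self, X,
      sum_range_succ]
  rw [h_run]
  refine (hs.setC_solSum (X (k + 1))).storeR ⟨fun i hi => ?_, fun i hi => ?_⟩
  · rw [cells_update_of_lt (by lia), State.rmem_setC, hs.mem.1 i hi]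
  · rcases Nat.lt_succ_iff_lt_or_eq.1 hi with h_lt | rfl
    · rw [Function.update_of_ne h_lt.ne, State.rmem_setC, hs.mem.2 i h_lt]
    · rw [Function.update_self]

/-- A bound for the cost of the decoder. -/
def decoderCost (n : ℕ) : ℕ :=
  let k := Nat.clog 2 (3 * n)
  blockCost initOps + (k * (blockCost growOps + 10) + 10) + (n + 1) * forCost inputSumOps
    + solveCost n k + (n + 1) * chirpCost sumOps + blockCost coeffOps
    + (n + 1) * chirpCost outputOps

theorem decoder_triple (b : Fin (2 * n) → ℝ) :
    Triple [polyMulProc] (· = inputState n b) decoderProgram.main (decoderCost n) fun s =>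
      ∀ i < n, s.rmem i
        = ∑ j ∈ range (i + 1), (leastSquares n (fun a => (inputState n b).rmem a) j).re := by
  have h_init : Triple [polyMulProc] (· = inputState n b) (block initOps) (blockCost initOps)
      (Stage n n 2 0 0 0 0 fun m => cells m = cells (inputState n b).rmem) :=
    Triple.block fun s hs => by
      have h_creg (x : ℕ) : (inputState n b).creg x = 0 := rfl
      have h_size : (inputState n b).nreg sizeReg = n := rfl
      subst hs
      constructor <;> simp [initOps, blockRun, Op.run, NExp.eval, CExp.eval, h_creg, h_size]
  have h_input (a : ℕ) (ha : 2 * n ≤ a) : (inputState n b).rmem a = 0 := dif_neg (not_lt.2 ha)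
  exact (h_init.seq <| growBlock_triple.seq <| inputSum_triple.seq <|
    (solve_triple (Nat.le_pow_clog one_lt_two _) h_input).seq <| sum_triple.seq <|
    coeff_triple.seq <| output_triple (Nat.le_add_right _ _)).mono
      (by simp only [decoderCost, add_assoc, le_refl])

end decoder

theorem exists_convCost_le (a f : CExp) :
    ∃ C, ∀ n k, 3 * n ≤ 2 ^ k → convCost n k a f ≤ C * ((k + 1) * 2 ^ k) := by
  obtain ⟨D, hD⟩ : ∃ D, ∀ k, polyMulCost k ≤ D * ((k + 1) * 2 ^ k) := ⟨_, polyMulCost_le⟩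
  refine ⟨chirpCost (loadOps a f) + (blockCost [.setC modReg .I] + (D + 1)), fun n k hn => ?_⟩
  have h_one : 1 ≤ 2 ^ k := Nat.one_le_two_pow
  have h_size : n + 1 ≤ (k + 1) * 2 ^ k := by nlinarith
  calc convCost n k a f
      ≤ (k + 1) * 2 ^ k * chirpCost (loadOps a f)
        + ((k + 1) * 2 ^ k * blockCost [.setC modReg .I]
          + (D * ((k + 1) * 2 ^ k) + (k + 1) * 2 ^ k)) := by
        rw [convCost]
        gcongr
        · exact Nat.le_mul_of_pos_left _ (by positivity)
        · exact hD k
        · lia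
    _ = _ := by ring

theorem exists_decoderCost_le :
    ∃ C, ∀ n, decoderCost n ≤ C * ((Nat.clog 2 (3 * n) + 1) * 2 ^ Nat.clog 2 (3 * n)) := by
  obtain ⟨C₁, h_fold⟩ := exists_convCost_le foldExp (.reg sqReg)
  obtain ⟨C₂, h_spectrum⟩ := exists_convCost_le spectrumExp (.conj (.reg sqReg))
  refine ⟨blockCost initOps + (blockCost growOps + 20) + forCost inputSumOps
    + (C₁ + (blockCost nextBlockOps + C₂)) + chirpCost sumOps + blockCost coeffOps
    + chirpCost outputOps, fun n => ?_⟩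
  have h_room : 3 * n ≤ 2 ^ Nat.clog 2 (3 * n) := Nat.le_pow_clog one_lt_two _
  rw [decoderCost]
  generalize Nat.clog 2 (3 * n) = k at *
  have h_one : 1 ≤ 2 ^ k := Nat.one_le_two_pow
  have h_size : n + 1 ≤ (k + 1) * 2 ^ k := by nlinarith
  have h_exponent : k ≤ (k + 1) * 2 ^ k := by nlinarith
  have h_const (x : ℕ) : x ≤ (k + 1) * 2 ^ k * x := Nat.le_mul_of_pos_left _ (by positivity)
  calc blockCost initOps + (k * (blockCost growOps + 10) + 10) + (n + 1) * forCost inputSumOps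
        + solveCost n k + (n + 1) * chirpCost sumOps + blockCost coeffOps
        + (n + 1) * chirpCost outputOps
      ≤ (k + 1) * 2 ^ k * blockCost initOps
        + ((k + 1) * 2 ^ k * (blockCost growOps + 10) + (k + 1) * 2 ^ k * 10)
        + (k + 1) * 2 ^ k * forCost inputSumOps
        + (C₁ * ((k + 1) * 2 ^ k)
          + ((k + 1) * 2 ^ k * blockCost nextBlockOps + C₂ * ((k + 1) * 2 ^ k)))
        + (k + 1) * 2 ^ k * chirpCost sumOps + (k + 1) * 2 ^ k * blockCost coeffOps
        + (k + 1) * 2 ^ k * chirpCost outputOps := by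
        rw [solveCost]
        gcongr
        · exact h_const _
        · exact h_const _
        · exact h_fold n k h_room
        · exact h_const _
        · exact h_spectrum n k h_room
        · exact h_const _
    _ = _ := by ring

theorem clog_mul_two_pow_clog_isBigO :
    (fun n : ℕ => (((Nat.clog 2 (3 * n) + 1) * 2 ^ Nat.clog 2 (3 * n) : ℕ) : ℝ))
      =O[Filter.atTop] fun n : ℕ => (n : ℝ) * Real.log n := by
  have h_log_two : 0 < Real.log 2 := Real.log_pos one_lt_two
  refine Asymptotics.IsBigO.of_bound (12 / Real.log 2) ?_
  filter_upwards [Filter.eventually_ge_atTop 12] with n hn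
  set k := Nat.clog 2 (3 * n)
  have h_pow : 2 ^ k ≤ 6 * n := by
    have h_pred : 2 ^ (k - 1) < 3 * n := Nat.pow_pred_clog_lt_self one_lt_two (by lia)
    have h_succ : 2 ^ k = 2 * 2 ^ (k - 1) := by
      rw [← pow_succ', Nat.sub_add_cancel (Nat.clog_pos one_lt_two (by lia))]
    lia
  have h_exponent : (k + 1 : ℝ) * Real.log 2 ≤ 2 * Real.log n := by
    have h_sq : 2 ^ (k + 1) ≤ n ^ 2 := by rw [pow_succ]; nlinarith
    have h_log := Real.log_le_log (by positivity) (Nat.cast_le (α := ℝ).2 h_sq)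
    push_cast at h_log
    rw [Real.log_pow, Real.log_pow] at h_log
    exact_mod_cast h_log
  rw [Real.norm_of_nonneg (by positivity), Real.norm_of_nonneg (by positivity),
    div_mul_eq_mul_div, le_div_iff₀ h_log_two]
  calc (((k + 1) * 2 ^ k : ℕ) : ℝ) * Real.log 2 = (k + 1 : ℝ) * Real.log 2 * (2 ^ k : ℕ) := by
        push_cast
        ring
    _ ≤ 2 * Real.log n * (6 * n : ℕ) := by gcongr
    _ = 12 * (n * Real.log n) := by
        push_cast
        ring

theorem decoderCost_isBigO :
    (fun n => (decoderCost n : ℝ)) =O[Filter.atTop] fun n : ℕ => (n : ℝ) * Real.log n := by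
  obtain ⟨C, hC⟩ := exists_decoderCost_le
  refine (Asymptotics.IsBigO.of_bound C (.of_forall fun n => ?_)).trans clog_mul_two_pow_clog_isBigO
  simpa using mod_cast hC n

theorem mul_log_isBigO_mul_log_sq : (fun n : ℕ => (n : ℝ) * Real.log n)
    =O[Filter.atTop] fun n : ℕ => (n : ℝ) * Real.log n ^ 2 := by
  have h_log : ∀ᶠ n : ℕ in Filter.atTop, 1 ≤ Real.log n :=
    (Real.tendsto_log_atTop.comp tendsto_natCast_atTop_atTop).eventually_ge_atTop 1
  refine (Asymptotics.isBigO_refl _ _).mul (.of_bound' (h_log.mono fun n hn => ?_))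
  rw [norm_pow]
  exact le_self_pow₀ (hn.trans (le_abs_self _)) two_ne_zero

end RealRAM

theorem mainTheorem11_general :
    ∃ (P : RealRAM.Program) (T : ℕ → ℕ),
      (∀ (n : ℕ) (b : Fin (2 * n) → ℝ), ∃ (t : ℕ) (s : RealRAM.State),
        P.HaltsIn (RealRAM.inputState n b) t s ∧ t ≤ T n ∧
          ∀ i : Fin n, ((s.rmem i : ℝ) : ℂ) =
            (FFTMech.optDecoder n *ᵥ fun j => ((b j : ℝ) : ℂ)) i) ∧
      (fun n : ℕ => (T n : ℝ)) =O[Filter.atTop] (fun n : ℕ => (n : ℝ) * Real.log n) := by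
  refine ⟨RealRAM.decoderProgram, RealRAM.decoderCost, fun n b => ?_, RealRAM.decoderCost_isBigO⟩
  obtain ⟨t, s, ht, h_exec, h_out⟩ := RealRAM.decoder_triple b _ rfl
  refine ⟨t, s, h_exec, ht, fun i => ?_⟩
  have h_input (j : Fin (2 * n)) : (RealRAM.inputState n b).rmem j = b j := dif_pos j.2
  rw [h_out i i.2, ← FFTMech.optDecoder_mulVec]
  simp only [h_input]

/-- One real-RAM program, the same for all `n`, evaluates `b ↦ B_Fopt b` exactly (the result is
left in the first `n` cells of the real memory) in worst-case time `O(n log² n)`. -/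
theorem mainTheorem11 :
    ∃ (P : RealRAM.Program) (T : ℕ → ℕ),
      (∀ (n : ℕ) (b : Fin (2 * n) → ℝ), ∃ (t : ℕ) (s : RealRAM.State),
        P.HaltsIn (RealRAM.inputState n b) t s ∧ t ≤ T n ∧
          ∀ i : Fin n, ((s.rmem i : ℝ) : ℂ) =
            (FFTMech.optDecoder n *ᵥ fun j => ((b j : ℝ) : ℂ)) i) ∧
      (fun n : ℕ => (T n : ℝ)) =O[Filter.atTop] (fun n : ℕ => (n : ℝ) * Real.log n ^ 2) := by
  obtain ⟨P, T, h_runs, h_time⟩ := mainTheorem11_general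
  exact ⟨P, T, h_runs, h_time.trans RealRAM.mul_log_isBigO_mul_log_sq⟩
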